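/- Consider the process $x_{k+1}=Ax_k+w_k$ in $\mathbb{R}^n$ with process noise covariance $Q\ge 0$ and initial covariance $\Sigma_0\ge 0$, observed by $M$ sensors $y_{m,k}=C_mx_k+v_{m,k}$ with measurement noise covariances $R_m>0$. Assume that every pair $(A,C_m)$ is detectable and that $(A,Q^{1/2})$ is stabilizable. Let $P^s_{m,k|k}$ be the filtered error covariance of the local Kalman filter of sensor $m$, that is, $P^s_{m,0|-1}=\Sigma_0$, $P^s_{m,k|k}=P^s_{m,k|k-1}-P^s_{m,k|k-1}C_m^T(C_mP^s_{m,k|k-1}C_m^T+R_m)^{-1}C_mP^s_{m,k|k-1}$ and $P^s_{m,k+1|k}=f(P^s_{m,k|k})$, where $f(X)=AXA^T+Q$. Let $\lambda_m\in[0,1]$ be the packet reception probabilities, $E_m\ge 0$ the transmission costs and $\beta\in(0,1)$. Suppose that $A$ is stable (all its eigenvalues $\sigma_i(A)$ satisfy $|\sigma_i(A)|<1$), or that $\lambda_m>1-\frac{1}{\max_i|\sigma_i(A)|^2}$ for at least one $m\in\{1,\dots,M\}$. Then the steady-state covariances $\bar P_m=\lim_{k\to\infty}P^s_{m,k|k}$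 exist, and, with $\mathcal S=\{f^i(\bar P_m): 1\le m\le M,\ i\ge 0\}$ and $\mathcal V\subset\{0,1\}^M$ the set consisting of $0$ and the $M$ unit vectors, there exist a constant $\rho\in\mathbb{R}$ and a function $h:\mathcal S\to\mathbb{R}$ satisfying the Bellman equation: for all $\tilde P\in\mathcal S$, $$\rho+h(\tilde P)=\min_{\nu\in\mathcal V}\Big\{\beta\Big[\sum_{m=1}^M s_m(\nu)\lambda_m\operatorname{tr}\bar P_m+\Big(1-\sum_{m=1}^M s_m(\nu)\lambda_m\Big)\operatorname{tr}f(\tilde P)\Big]+(1-\beta)\sum_{m=1}^M\nu_mE_m+\sum_{m=1}^M s_m(\nu)\lambda_m h(\bar P_m)+\Big(1-\sum_{m=1}^M s_m(\nu)\lambda_m\Big)h(f(\tilde P))\Big\},$$ where $s_m(\nu)=\nu_m\prod_{j\ne m}(1-\nu_j)$. Moreover, for this $(\rho,h)$ there is a stationary policy $d:\mathcal S\to\mathcal V$, with $d(\tilde P)$ attaining the minimum in the Bellman equation at each $\tilde P\in\mathcal S$, that is optimal with optimal average cost $\rho$ in the following sense. Let $\gamma_{m,k}$ be independent Bernoulli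 variables with $\mathbb{P}(\gamma_{m,k}=1)=\lambda_m$. For a policy $\pi=(\pi_k)_{k\ge1}$, $\pi_k:\mathcal S\to\{0,1\}^M$, and an initial state $\tilde P_{0|0}\in\mathcal S$, put $\nu_k=(\nu_{1,k},\dots,\nu_{M,k})=\pi_k(\tilde P_{k-1|k-1})$, and let $\tilde P_{k|k}=\bar P_m$ if $\gamma_{m,k}=1$ and $m$ is the only sensor with $\nu_{m,k}=1$, and $\tilde P_{k|k}=f(\tilde P_{k-1|k-1})$ otherwise (no transmission, a collision, or a dropped packet). Then for every $\tilde P_{0|0}\in\mathcal S$ the average cost $$\limsup_{K\to\infty}\frac1K\sum_{k=1}^K\mathbb{E}\Big[\beta\operatorname{tr}\tilde P_{k|k}+(1-\beta)\sum_{m=1}^M\nu_{m,k}E_m\Big]$$ is at least $\rho$ (possibly $+\infty$) for every policy $\pi$, and equals $\rho$ for the policy $\pi_k=d$ for all $k$. -/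

import Mathlib

open Filter Topology MeasureTheory ProbabilityTheory

open scoped MatrixOrder

noncomputable section

namespace SensorScheduling

/-- All eigenvalues of the real square matrix `A` lie in the open unit disc. -/
def IsStable {n : ℕ} (A : Matrix (Fin n) (Fin n) ℝ) : Prop :=
  ∀ z ∈ spectrum ℂ (A.map (fun x : ℝ => (x : ℂ))), ‖z‖ < 1

/-- The largest modulus of an eigenvalue of `A`. -/
def maxAbsEigenvalue {n : ℕ} (A : Matrix (Fin n) (Fin n) ℝ) : ℝ :=
  (spectralRadius ℂ (A.map (fun x : ℝ => (x : ℂ)))).toReal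

/-- `(A, C)` is detectable: some output injection makes `A - L C` stable. -/
def IsDetectable {n p : ℕ} (A : Matrix (Fin n) (Fin n) ℝ) (C : Matrix (Fin p) (Fin n) ℝ) : Prop :=
  ∃ L : Matrix (Fin n) (Fin p) ℝ, IsStable (A - L * C)

/-- `(A, B)` is stabilizable: some state feedback makes `A + B K` stable. -/
def IsStabilizable {n p : ℕ} (A : Matrix (Fin n) (Fin n) ℝ) (B : Matrix (Fin n) (Fin p) ℝ) : Prop :=
  ∃ K : Matrix (Fin p) (Fin n) ℝ, IsStable (A + B * K)

/-- The parameters of a process `x_{k+1} = A x_k + w_k` observed by `M` sensors through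
`y_{m,k} = C_m x_k + v_{m,k}`, and of the scheduling problem for these sensors. -/
structure System (n M : ℕ) where
  /-- state matrix -/
  A : Matrix (Fin n) (Fin n) ℝ
  /-- covariance of the process noise `w_k` -/
  Q : Matrix (Fin n) (Fin n) ℝ
  /-- covariance of the initial state `x_0` -/
  Sigma0 : Matrix (Fin n) (Fin n) ℝ
  /-- dimension of the measurements of each sensor -/
  dim : Fin M → ℕ
  /-- measurement matrices -/
  C : (m : Fin M) → Matrix (Fin (dim m)) (Fin n) ℝ
  /-- covariances of the measurement noises `v_{m,k}` -/
  R : (m : Fin M) → Matrix (Fin (dim m)) (Fin (dim m)) ℝ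
  /-- packet reception probabilities -/
  lam : Fin M → ℝ
  /-- transmission costs -/
  E : Fin M → ℝ
  /-- weight of the estimation error against the energy -/
  beta : ℝ

variable {n M : ℕ}

/-- The standing assumptions on the parameters. -/
structure System.Admissible (s : System n M) : Prop where
  posSemidef_Q : s.Q.PosSemidef
  posSemidef_Sigma0 : s.Sigma0.PosSemidef
  posDef_R : ∀ m, (s.R m).PosDef
  detectable : ∀ m, IsDetectable s.A (s.C m)
  stabilizable : IsStabilizable s.A (CFC.sqrt s.Q)
  lam_mem : ∀ m, s.lam m ∈ Set.Icc (0 : ℝ) 1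
  E_nonneg : ∀ m, 0 ≤ s.E m
  beta_mem : s.beta ∈ Set.Ioo (0 : ℝ) 1

/-- `f(X) = A X Aᵀ + Q`. -/
def System.f (s : System n M) (X : Matrix (Fin n) (Fin n) ℝ) : Matrix (Fin n) (Fin n) ℝ :=
  s.A * X * s.A.transpose + s.Q

/-- Measurement update `P - P Cᵀ (C P Cᵀ + R)⁻¹ C P` of the local Kalman filter of sensor `m`. -/
def System.measUpdate (s : System n M) (m : Fin M) (P : Matrix (Fin n) (Fin n) ℝ) :
    Matrix (Fin n) (Fin n) ℝ :=
  P - P * (s.C m).transpose * (s.C m * P * (s.C m).transpose + s.R m)⁻¹ * s.C m * P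

/-- The predicted covariance `P^s_{m,k|k-1}` of the local Kalman filter of sensor `m`. -/
def System.localPrior (s : System n M) (m : Fin M) : ℕ → Matrix (Fin n) (Fin n) ℝ
  | 0 => s.Sigma0
  | k + 1 => s.f (s.measUpdate m (s.localPrior m k))

/-- The filtered covariance `P^s_{m,k|k}` of the local Kalman filter of sensor `m`. -/
def System.localPost (s : System n M) (m : Fin M) (k : ℕ) : Matrix (Fin n) (Fin n) ℝ :=
  s.measUpdate m (s.localPrior m k)

/-- A decision `(ν_1, …, ν_M) ∈ {0,1}^M`: `ν m = true` when sensor `m` is to transmit. -/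
abbrev Action (M : ℕ) : Type := Fin M → Bool

/-- A Boolean as the real number `0` or `1`. -/
def ind (b : Bool) : ℝ := if b then 1 else 0

/-- The decisions in which at most one sensor transmits: `e_0 = 0` and the unit vectors `e_m`. -/
def actionsV (M : ℕ) : Set (Action M) :=
  insert (fun _ => false) (Set.range fun m : Fin M => fun j : Fin M => decide (j = m))

/-- `ν_m ∏_{j ≠ m} (1 - ν_j)`: equal to `1` if `m` is the only transmitting sensor, else `0`. -/
def solo (ν : Action M) (m : Fin M) : ℝ :=
  ind (ν m) * ∏ j ∈ Finset.univ.erase m, (1 - ind (ν j))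

/-- The countable state space `{f^i(P̄_m) : m, i}`. -/
def System.states (s : System n M) (Pbar : Fin M → Matrix (Fin n) (Fin n) ℝ) :
    Set (Matrix (Fin n) (Fin n) ℝ) :=
  {P | ∃ (m : Fin M) (i : ℕ), P = s.f^[i] (Pbar m)}

/-- The expression minimised over the decisions `ν` on the right of the Bellman equation. -/
def System.bellmanRHS (s : System n M) (Pbar : Fin M → Matrix (Fin n) (Fin n) ℝ)
    (h : Matrix (Fin n) (Fin n) ℝ → ℝ) (P : Matrix (Fin n) (Fin n) ℝ) (ν : Action M) : ℝ :=
  s.beta * ((∑ m, solo ν m * s.lam m * (Pbar m).trace)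
      + (1 - ∑ m, solo ν m * s.lam m) * (s.f P).trace)
    + (1 - s.beta) * ∑ m, ind (ν m) * s.E m
    + (∑ m, solo ν m * s.lam m * h (Pbar m))
    + (1 - ∑ m, solo ν m * s.lam m) * h (s.f P)

/-- A transmission policy: the decision for time `k` as a function of the error covariance at
the remote estimator at time `k - 1`. -/
abbrev Policy (n M : ℕ) : Type := ℕ → Matrix (Fin n) (Fin n) ℝ → Action M

/-- The error covariance at the remote estimator one step after `P`, when the decision is `ν`
and `g m` says whether the channel lets a packet of sensor `m` through: it is `P̄_m` if `m` is
the only transmitting sensor and its packet gets through, and `f(P)` if no packet is received. -/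
def System.next (s : System n M) (Pbar : Fin M → Matrix (Fin n) (Fin n) ℝ)
    (P : Matrix (Fin n) (Fin n) ℝ) (ν : Action M) (g : Fin M → Bool) :
    Matrix (Fin n) (Fin n) ℝ :=
  (∑ m, (solo ν m * ind (g m)) • Pbar m) + (1 - ∑ m, solo ν m * ind (g m)) • s.f P

/-- The error covariance `P̃_{k|k}` at the remote estimator under the policy `π`, started at
`P̃_{0|0} = P₀`. -/
def System.remoteCov {Ω : Type*} (s : System n M) (Pbar : Fin M → Matrix (Fin n) (Fin n) ℝ)
    (γ : Fin M → ℕ → Ω → Bool) (π : Policy n M) (P₀ : Matrix (Fin n) (Fin n) ℝ) :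
    ℕ → Ω → Matrix (Fin n) (Fin n) ℝ
  | 0, _ => P₀
  | k + 1, ω =>
      s.next Pbar (s.remoteCov Pbar γ π P₀ k ω) (π (k + 1) (s.remoteCov Pbar γ π P₀ k ω))
        (fun m => γ m (k + 1) ω)

/-- The cost `β tr P̃_{k+1|k+1} + (1 - β) ∑ₘ ν_{m,k+1} E_m` of the stage `k + 1`. -/
def System.stageCost {Ω : Type*} (s : System n M) (Pbar : Fin M → Matrix (Fin n) (Fin n) ℝ)
    (γ : Fin M → ℕ → Ω → Bool) (π : Policy n M) (P₀ : Matrix (Fin n) (Fin n) ℝ)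
    (k : ℕ) (ω : Ω) : ℝ :=
  s.beta * (s.remoteCov Pbar γ π P₀ (k + 1) ω).trace
    + (1 - s.beta) * ∑ m, ind (π (k + 1) (s.remoteCov Pbar γ π P₀ k ω) m) * s.E m

/-- The long-run average cost `limsup_K (1/K) ∑_{k=1}^K 𝔼[cost of stage k]`, which may be `⊤`.
The integrands are measurable and take finitely many values when the `γ m k` are measurable. -/
def System.averageCost {Ω : Type*} [MeasurableSpace Ω] (s : System n M)
    (Pbar : Fin M → Matrix (Fin n) (Fin n) ℝ) (μ : Measure Ω)
    (γ : Fin M → ℕ → Ω → Bool) (π : Policy n M) (P₀ : Matrix (Fin n) (Fin n) ℝ) : EReal :=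
  limsup (fun K : ℕ =>
    (((1 / (K : ℝ)) * ∑ k ∈ Finset.range K, ∫ ω, s.stageCost Pbar γ π P₀ k ω ∂μ : ℝ) : EReal))
    atTop

/-- The `γ m k` are independent, and `γ m k` is Bernoulli with success probability `lam m`. -/
structure IsBernoulliChannel {Ω : Type*} [MeasurableSpace Ω] (μ : Measure Ω)
    (lam : Fin M → ℝ) (γ : Fin M → ℕ → Ω → Bool) : Prop where
  measurable : ∀ m k, Measurable (γ m k)
  indep : iIndepFun (fun i : Fin M × ℕ => γ i.1 i.2) μ
  prob : ∀ m k, μ {ω | γ m k ω = true} = ENNReal.ofReal (lam m)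

end SensorScheduling

end

/-!
The proof has three independent parts.

*Local filters.* A Riccati step is the minimum, in the Loewner order, of the affine steps
`P ↦ (A - L C) P (A - L C)ᵀ + L R Lᵀ + Q` over the gains `L` (`gainStep_sub_eq`). The iterates from
`0` increase and, by detectability, are bounded, so they converge to a fixed point `P`.
Stabilizability makes the gain of `P` stabilizing (`isStable_of_riccati_fixed`): a left eigenvector
of the closed loop outside the open disc would be a left eigenvector of `A` that the process noise
does not excite.
The iterates from any other initial covariance lie between those from `0` and those of the constant
gain of `P`, and both converge to `P` (`exists_tendsto_riccatiOrbit`).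

*Bellman equation.* The scheduling problem is a controlled process that is either reset to one of
finitely many states or moved by `f`. The value functions `V α` of the discounted problems, taken
relative to a fixed state `x₀`, are bounded pointwise uniformly in `α`, and every state has finitely
many successors, so a limit along an ultrafilter `α → 1` solves the average cost equation
(`ResetProcess.exists_bellman_of_bounds`). The bounds come from two sources. If `A` is stable, the
costs along any two silent orbits differ by a summable amount. If `A` is not stable, `x₀` is the
reset state `P̄_m` of a sensor whose reception probability beats the growth of `A`: letting this
sensor transmit until a reception costs finitely much, which bounds `V α - V α x₀` above. Below, all
reset states with positive probability are comparable to `x₀`, and the silent orbits have diverging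
costs because the noise excites an unstable mode, so that far out on an orbit it cannot be cheaper
than at `x₀` (`ResetProcess.IsResetBound.exists_le_sub`). The relative value `h` obtained this way
is bounded below on the states, and bounded above by an affine function of the trace.

*Optimality.* The expected stage costs telescope against the expectations of `h`. The lower bound of
`h` gives average cost at most `ρ` for the minimizing policy. For an arbitrary policy the terminal
term `𝔼 h` need not be bounded, but it is dominated by the last stage cost: if the average were
below `ρ`, this term would grow linearly, and the average would diverge (`le_limsup_average`).
-/

namespace SensorScheduling

open Matrix

/-! ### Powers and left eigenvectors of a matrix -/

section Spectrum

attribute [local instance] Matrix.linftyOpNormedRing Matrix.linftyOpNormedAlgebra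

/-- Gelfand's formula, entrywise: the powers of `A` grow at most like `t ^ k` for every `t` beyond
the spectral radius. -/
theorem exists_abs_pow_apply_le {n : ℕ} (A : Matrix (Fin n) (Fin n) ℝ) {t : ℝ} (ht : 0 < t)
    (h : spectralRadius ℂ (A.map (fun x : ℝ => (x : ℂ))) < ENNReal.ofReal t) :
    ∃ C : ℝ, 0 ≤ C ∧ ∀ k i j, |(A ^ k) i j| ≤ C * t ^ k := by
  set B : Matrix (Fin n) (Fin n) ℂ := A.map (fun x : ℝ => (x : ℂ)) with hB
  have hpow : ∀ k, B ^ k = (A ^ k).map (fun x : ℝ => (x : ℂ)) := fun k =>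
    (Matrix.map_pow A (Complex.ofRealHom) k).symm
  have hlim := spectrum.pow_norm_pow_one_div_tendsto_nhds_spectralRadius B
  have hO : (fun k => B ^ k) =O[atTop] fun k : ℕ => t ^ k := by
    refine Asymptotics.IsBigO.of_bound 1 ?_
    filter_upwards [hlim.eventually_lt_const h, eventually_ge_atTop 1] with k hk hk1
    have hk0 : k ≠ 0 := by omega
    rw [ENNReal.ofReal_lt_ofReal_iff ht] at hk
    have := pow_le_pow_left₀ (by positivity) hk.le k
    rw [one_div, Real.rpow_inv_natCast_pow (norm_nonneg _) hk0] at this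
    rw [one_mul, Real.norm_of_nonneg (by positivity)]
    exact this
  obtain ⟨C, hC, hbound⟩ := Asymptotics.bound_of_isBigO_nat_atTop hO
  refine ⟨C, hC.le, fun k i j => ?_⟩
  have h1 := hbound (x := k) (by positivity)
  rw [Real.norm_of_nonneg (by positivity)] at h1
  refine le_trans ?_ h1
  have h2 : ‖(B ^ k) i j‖ ≤ ‖B ^ k‖ := by
    have h3 := Matrix.linfty_opNorm_mulVec (B ^ k) (Pi.single j 1)
    have h4 := (norm_le_pi_norm ((B ^ k) *ᵥ (Pi.single j 1)) i).trans h3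
    rw [Pi.norm_single, norm_one, mul_one] at h4
    simpa using h4
  rw [hpow] at h2
  rw [hpow]
  simpa using h2

/-- The powers of a stable matrix decay geometrically. -/
theorem IsStable.exists_abs_pow_apply_le {n : ℕ} {A : Matrix (Fin n) (Fin n) ℝ} (hA : IsStable A) :
    ∃ C r : ℝ, 0 ≤ C ∧ 0 < r ∧ r < 1 ∧ ∀ k i j, |(A ^ k) i j| ≤ C * r ^ k := by
  rcases Nat.eq_zero_or_pos n with rfl | hn
  · exact ⟨0, 1 / 2, le_rfl, by norm_num, by norm_num, fun k i => i.elim0⟩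
  have : Nonempty (Fin n) := ⟨⟨0, hn⟩⟩
  have h1 : spectralRadius ℂ (A.map (fun x : ℝ => (x : ℂ))) < ((1 : NNReal) : ENNReal) :=
    spectrum.spectralRadius_lt_of_forall_lt _ fun z hz => by
      have := hA z hz
      exact_mod_cast this
  obtain ⟨r, hr0, hr1⟩ := ENNReal.lt_iff_exists_nnreal_btwn.mp h1
  have hr1' : r < 1 := by exact_mod_cast hr1
  have hpos : 0 < r := by
    rcases eq_zero_or_pos r with rfl | h
    · simp at hr0
    · exact h
  obtain ⟨C, hC, hb⟩ := SensorScheduling.exists_abs_pow_apply_le A (t := r) (by exact_mod_cast hpos)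
    (by rwa [ENNReal.ofReal_coe_nnreal])
  exact ⟨C, r, hC, by exact_mod_cast hpos, by exact_mod_cast hr1', hb⟩

/-- An unstable matrix has a largest eigenvalue of modulus at least one. -/
theorem one_le_maxAbsEigenvalue {n : ℕ} {A : Matrix (Fin n) (Fin n) ℝ} (hA : ¬ IsStable A) :
    1 ≤ maxAbsEigenvalue A := by
  simp only [IsStable, not_forall, not_lt] at hA
  obtain ⟨z, hz, h1⟩ := hA
  have hn : Nonempty (Fin n) := by
    by_contra hne
    rw [not_nonempty_iff] at hne
    rw [spectrum.of_subsingleton] at hz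
    exact hz
  have h2 : (‖z‖₊ : ENNReal) ≤ spectralRadius ℂ (A.map (fun x : ℝ => (x : ℂ))) :=
    le_iSup₂ (f := fun z _ => (‖z‖₊ : ENNReal)) z hz
  have h3 : spectralRadius ℂ (A.map (fun x : ℝ => (x : ℂ))) ≠ ⊤ :=
    ((spectrum.spectralRadius_le_nnnorm _).trans_lt ENNReal.coe_lt_top).ne
  have := ENNReal.toReal_mono h3 h2
  simp only [ENNReal.coe_toReal, coe_nnnorm] at this
  exact h1.trans this

/-- The powers of `A` grow at most like `t ^ k` for every `t` beyond the largest modulus of an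
eigenvalue. -/
theorem exists_abs_pow_apply_le_of_maxAbsEigenvalue_lt {n : ℕ} (A : Matrix (Fin n) (Fin n) ℝ)
    {t : ℝ} (ht : maxAbsEigenvalue A < t) :
    ∃ C : ℝ, 0 ≤ C ∧ ∀ k i j, |(A ^ k) i j| ≤ C * t ^ k := by
  rcases Nat.eq_zero_or_pos n with rfl | hn
  · exact ⟨0, le_rfl, fun k i => i.elim0⟩
  have : Nonempty (Fin n) := ⟨⟨0, hn⟩⟩
  have h3 : spectralRadius ℂ (A.map (fun x : ℝ => (x : ℂ))) ≠ ⊤ :=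
    ((spectrum.spectralRadius_le_nnnorm _).trans_lt ENNReal.coe_lt_top).ne
  have h0 : 0 ≤ maxAbsEigenvalue A := ENNReal.toReal_nonneg
  refine exists_abs_pow_apply_le A (h0.trans_lt ht) ?_
  exact (ENNReal.lt_ofReal_iff_toReal_lt h3).mpr ht

end Spectrum

/-- A complex left eigenvector `u + i v` of a real matrix, for the eigenvalue `a + i b`, written
with real vectors. -/
structure IsLeftEigenpair {n : ℕ} (A : Matrix (Fin n) (Fin n) ℝ) (a b : ℝ) (u v : Fin n → ℝ) :
    Prop where
  re : u ᵥ* A = a • u - b • v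
  im : v ᵥ* A = b • u + a • v
  ne_zero : u ≠ 0 ∨ v ≠ 0

theorem mem_spectrum_iff_exists_vecMul {n : ℕ} (B : Matrix (Fin n) (Fin n) ℂ) (z : ℂ) :
    z ∈ spectrum ℂ B ↔ ∃ w, w ≠ 0 ∧ w ᵥ* B = z • w := by
  rw [spectrum.mem_iff, Matrix.isUnit_iff_isUnit_det, isUnit_iff_ne_zero, not_not,
    ← Matrix.exists_vecMul_eq_zero_iff]
  refine exists_congr fun w => and_congr_right fun _ => ?_
  rw [Matrix.vecMul_sub, sub_eq_zero, eq_comm, Algebra.algebraMap_eq_smul_one,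
    Matrix.vecMul_smul, Matrix.vecMul_one]

theorem vecMul_map_ofReal {n : ℕ} (A : Matrix (Fin n) (Fin n) ℝ) (w : Fin n → ℂ) (j : Fin n) :
    (w ᵥ* A.map (fun x : ℝ => (x : ℂ))) j
      = ⟨((fun i => (w i).re) ᵥ* A) j, ((fun i => (w i).im) ᵥ* A) j⟩ := by
  apply Complex.ext <;> simp [Matrix.vecMul, dotProduct]

theorem exists_isLeftEigenpair {n : ℕ} {A : Matrix (Fin n) (Fin n) ℝ} (hA : ¬ IsStable A) :
    ∃ a b u v, IsLeftEigenpair A a b u v ∧ 1 ≤ a ^ 2 + b ^ 2 := by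
  simp only [IsStable, not_forall, not_lt] at hA
  obtain ⟨z, hz, h1⟩ := hA
  obtain ⟨w, hw, h⟩ := (mem_spectrum_iff_exists_vecMul _ z).mp hz
  have hj := fun j => (vecMul_map_ofReal A w j).symm.trans (congrFun h j)
  refine ⟨z.re, z.im, fun i => (w i).re, fun i => (w i).im, ⟨?_, ?_, ?_⟩, ?_⟩
  · ext j
    simpa using congrArg Complex.re (hj j)
  · ext j
    have := congrArg Complex.im (hj j)
    simp only [Pi.smul_apply, smul_eq_mul, Complex.mul_im, Pi.add_apply] at this ⊢
    linarith
  · by_contra hne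
    push Not at hne
    exact hw (funext fun i => Complex.ext (congrFun hne.1 i) (congrFun hne.2 i))
  · have : 1 ≤ ‖z‖ ^ 2 := one_le_pow₀ h1
    rw [Complex.sq_norm, Complex.normSq_apply] at this
    linarith

theorem IsLeftEigenpair.sq_add_sq_lt_one {n : ℕ} {A : Matrix (Fin n) (Fin n) ℝ} {a b : ℝ}
    {u v : Fin n → ℝ} (h : IsLeftEigenpair A a b u v) (hA : IsStable A) : a ^ 2 + b ^ 2 < 1 := by
  have hz : (⟨a, b⟩ : ℂ) ∈ spectrum ℂ (A.map (fun x : ℝ => (x : ℂ))) := by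
    rw [mem_spectrum_iff_exists_vecMul]
    refine ⟨fun i => ⟨u i, v i⟩, fun h0 => ?_, funext fun j => ?_⟩
    · rcases h.ne_zero with hu | hv
      · exact hu (funext fun i => by simpa using congrArg Complex.re (congrFun h0 i))
      · exact hv (funext fun i => by simpa using congrArg Complex.im (congrFun h0 i))
    · have h1 := congrFun h.re j
      have h2 := congrFun h.im j
      rw [vecMul_map_ofReal]
      apply Complex.ext
      · simpa using h1
      · simp only [Pi.smul_apply, smul_eq_mul, Pi.add_apply, Complex.mul_im] at h2 ⊢
        linarith
  have h1 := hA _ hz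
  have : ‖(⟨a, b⟩ : ℂ)‖ ^ 2 < 1 := pow_lt_one₀ (norm_nonneg _) h1 two_ne_zero
  rw [Complex.sq_norm, Complex.normSq_apply] at this
  simp only at this
  linarith

/-! ### Quadratic forms -/

theorem dotProduct_conj_mulVec {n p : ℕ} (B : Matrix (Fin n) (Fin p) ℝ)
    (X : Matrix (Fin p) (Fin p) ℝ) (x : Fin n → ℝ) :
    x ⬝ᵥ (B * X * Bᵀ) *ᵥ x = (x ᵥ* B) ⬝ᵥ X *ᵥ (x ᵥ* B) := by
  rw [← Matrix.mulVec_mulVec, ← Matrix.mulVec_mulVec, Matrix.dotProduct_mulVec,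
    Matrix.mulVec_transpose]

theorem transpose_eq_of_posSemidef {n : ℕ} {X : Matrix (Fin n) (Fin n) ℝ} (hX : X.PosSemidef) :
    Xᵀ = X := by
  rw [← Matrix.conjTranspose_eq_transpose_of_trivial]
  exact hX.isHermitian

theorem posSemidef_conj {n p : ℕ} (B : Matrix (Fin n) (Fin p) ℝ) {X : Matrix (Fin p) (Fin p) ℝ}
    (hX : X.PosSemidef) : (B * X * Bᵀ).PosSemidef := by
  have := hX.mul_mul_conjTranspose_same B
  rwa [Matrix.conjTranspose_eq_transpose_of_trivial] at this

theorem dotProduct_mulVec_nonneg_of_posSemidef {n : ℕ} {X : Matrix (Fin n) (Fin n) ℝ}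
    (hX : X.PosSemidef) (x : Fin n → ℝ) : 0 ≤ x ⬝ᵥ X *ᵥ x := by
  simpa using hX.dotProduct_mulVec_nonneg x

theorem dotProduct_mulVec_comm_of_transpose_eq {n : ℕ} {X : Matrix (Fin n) (Fin n) ℝ}
    (hX : Xᵀ = X) (x y : Fin n → ℝ) : x ⬝ᵥ X *ᵥ y = y ⬝ᵥ X *ᵥ x := by
  rw [dotProduct_comm, ← Matrix.vecMul_transpose, ← Matrix.dotProduct_mulVec, hX]

theorem IsLeftEigenpair.conj_add_conj {n : ℕ} {A X : Matrix (Fin n) (Fin n) ℝ} {a b : ℝ}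
    {u v : Fin n → ℝ} (h : IsLeftEigenpair A a b u v) (hX : Xᵀ = X) :
    u ⬝ᵥ (A * X * Aᵀ) *ᵥ u + v ⬝ᵥ (A * X * Aᵀ) *ᵥ v
      = (a ^ 2 + b ^ 2) * (u ⬝ᵥ X *ᵥ u + v ⬝ᵥ X *ᵥ v) := by
  rw [dotProduct_conj_mulVec, dotProduct_conj_mulVec, h.re, h.im]
  simp only [Matrix.mulVec_sub, Matrix.mulVec_add, Matrix.mulVec_smul, sub_dotProduct,
    add_dotProduct, dotProduct_sub, dotProduct_add, smul_dotProduct, dotProduct_smul, smul_eq_mul]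
  rw [dotProduct_mulVec_comm_of_transpose_eq hX v u]
  ring

theorem single_add_single_dotProduct {n : ℕ} {X : Matrix (Fin n) (Fin n) ℝ} (hX : Xᵀ = X)
    (i j : Fin n) (s : ℝ) :
    (Pi.single i 1 + Pi.single j s) ⬝ᵥ X *ᵥ (Pi.single i 1 + Pi.single j s)
      = X i i + 2 * s * X i j + s ^ 2 * X j j := by
  have h : X j i = X i j := congrFun (congrFun hX i) j
  have hs : (Pi.single j s : Fin n → ℝ) = s • Pi.single j 1 := by
    rw [← Pi.single_smul, smul_eq_mul, mul_one]
  rw [hs]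
  simp only [Matrix.mulVec_add, Matrix.mulVec_smul, add_dotProduct, dotProduct_add,
    smul_dotProduct, dotProduct_smul, Matrix.mulVec_single_one, single_one_dotProduct,
    Matrix.col_apply, smul_eq_mul, h]
  ring

theorem abs_apply_le_trace {n : ℕ} {X : Matrix (Fin n) (Fin n) ℝ} (hX : X.PosSemidef)
    (i j : Fin n) : |X i j| ≤ X.trace := by
  have hd : ∀ l, 0 ≤ X l l := fun l => hX.diag_nonneg
  have hle : ∀ l, X l l ≤ X.trace := fun l =>
    Finset.single_le_sum (f := fun l => X l l) (fun l _ => hd l) (Finset.mem_univ l)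
  have h1 := dotProduct_mulVec_nonneg_of_posSemidef hX (Pi.single i 1 + Pi.single j 1)
  have h2 := dotProduct_mulVec_nonneg_of_posSemidef hX (Pi.single i 1 + Pi.single j (-1))
  rw [single_add_single_dotProduct (transpose_eq_of_posSemidef hX)] at h1 h2
  rw [abs_le]
  constructor <;> linarith [hle i, hle j]

/-- The sum of the absolute values of the entries. -/
def absSum {n : ℕ} (X : Matrix (Fin n) (Fin n) ℝ) : ℝ := ∑ i, ∑ j, |X i j|

theorem absSum_nonneg {n : ℕ} (X : Matrix (Fin n) (Fin n) ℝ) : 0 ≤ absSum X :=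
  Finset.sum_nonneg fun _ _ => Finset.sum_nonneg fun _ _ => abs_nonneg _

theorem absSum_le_trace {n : ℕ} {X : Matrix (Fin n) (Fin n) ℝ} (hX : X.PosSemidef) :
    absSum X ≤ (n : ℝ) ^ 2 * X.trace := by
  refine (Finset.sum_le_sum fun i _ => Finset.sum_le_sum fun j _ =>
    abs_apply_le_trace hX i j).trans ?_
  simp only [Finset.sum_const, Finset.card_univ, Fintype.card_fin, nsmul_eq_mul]
  exact le_of_eq (by ring)

theorem abs_sum_mul_mul_le {n : ℕ} (X : Matrix (Fin n) (Fin n) ℝ) {x y : Fin n → ℝ} {c : ℝ}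
    (hc : 0 ≤ c) (hx : ∀ i, |x i| ≤ c) (hy : ∀ i, |y i| ≤ c) :
    |x ⬝ᵥ X *ᵥ y| ≤ c ^ 2 * absSum X := by
  have : x ⬝ᵥ X *ᵥ y = ∑ i, ∑ j, x i * (X i j * y j) := by
    simp [dotProduct, Matrix.mulVec, Finset.mul_sum]
  rw [this, absSum, Finset.mul_sum]
  refine (Finset.abs_sum_le_sum_abs _ _).trans (Finset.sum_le_sum fun i _ => ?_)
  rw [Finset.mul_sum]
  refine (Finset.abs_sum_le_sum_abs _ _).trans (Finset.sum_le_sum fun j _ => ?_)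
  rw [abs_mul, abs_mul]
  have := mul_le_mul (hx i) (hy j) (abs_nonneg _) hc
  nlinarith [abs_nonneg (X i j)]

theorem dotProduct_mulVec_le_trace {n : ℕ} (x : Fin n → ℝ) :
    ∃ c : ℝ, 0 ≤ c ∧ ∀ X : Matrix (Fin n) (Fin n) ℝ, X.PosSemidef → x ⬝ᵥ X *ᵥ x ≤ c * X.trace := by
  have hx : ∀ i, |x i| ≤ ∑ j, |x j| := fun i =>
    Finset.single_le_sum (f := fun j => |x j|) (fun j _ => abs_nonneg _) (Finset.mem_univ i)
  refine ⟨(∑ j, |x j|) ^ 2 * (n : ℝ) ^ 2, by positivity, fun X hX => ?_⟩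
  refine (le_abs_self _).trans ((abs_sum_mul_mul_le X
    (Finset.sum_nonneg fun j _ => abs_nonneg _) hx hx).trans ?_)
  rw [mul_assoc]
  gcongr
  exact absSum_le_trace hX

theorem abs_conj_apply_le {n : ℕ} {B X : Matrix (Fin n) (Fin n) ℝ} {c : ℝ} (hc : 0 ≤ c)
    (hB : ∀ i j, |B i j| ≤ c) (i j : Fin n) : |(B * X * Bᵀ) i j| ≤ c ^ 2 * absSum X := by
  have : (B * X * Bᵀ) i j = B i ⬝ᵥ X *ᵥ B j := by
    rw [Matrix.dotProduct_mulVec]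
    simp [Matrix.mul_apply, dotProduct, Matrix.vecMul]
  rw [this]
  exact abs_sum_mul_mul_le X hc (hB i) (hB j)

theorem abs_trace_conj_le {n : ℕ} {B X : Matrix (Fin n) (Fin n) ℝ} {c : ℝ} (hc : 0 ≤ c)
    (hB : ∀ i j, |B i j| ≤ c) : |(B * X * Bᵀ).trace| ≤ n * (c ^ 2 * absSum X) := by
  refine (Finset.abs_sum_le_sum_abs _ _).trans
    ((Finset.sum_le_sum fun i _ => abs_conj_apply_le hc hB i i).trans ?_)
  simp

/-- Polarization: convergence of the quadratic forms gives convergence of the matrices. -/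
theorem tendsto_of_tendsto_dotProduct {n : ℕ} {X : ℕ → Matrix (Fin n) (Fin n) ℝ}
    {Y : Matrix (Fin n) (Fin n) ℝ} (hX : ∀ k, (X k)ᵀ = X k) (hY : Yᵀ = Y)
    (h : ∀ x : Fin n → ℝ, Tendsto (fun k => x ⬝ᵥ X k *ᵥ x) atTop (𝓝 (x ⬝ᵥ Y *ᵥ x))) :
    Tendsto X atTop (𝓝 Y) := by
  refine tendsto_pi_nhds.mpr fun i => tendsto_pi_nhds.mpr fun j => ?_
  have key : ∀ Z : Matrix (Fin n) (Fin n) ℝ, Zᵀ = Z → Z i j = 1 / 4 *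
      ((Pi.single i 1 + Pi.single j 1) ⬝ᵥ Z *ᵥ (Pi.single i 1 + Pi.single j 1)
        - (Pi.single i 1 + Pi.single j (-1)) ⬝ᵥ Z *ᵥ (Pi.single i 1 + Pi.single j (-1))) := by
    intro Z hZ
    rw [single_add_single_dotProduct hZ, single_add_single_dotProduct hZ]
    ring
  rw [key Y hY]
  simp_rw [fun k => key (X k) (hX k)]
  exact ((h _).sub (h _)).const_mul _

theorem exists_tendsto_of_monotone {n : ℕ} {X : ℕ → Matrix (Fin n) (Fin n) ℝ}
    (hX : ∀ k, (X k)ᵀ = X k)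
    (hmono : ∀ x : Fin n → ℝ, Monotone fun k => x ⬝ᵥ X k *ᵥ x)
    (hbdd : ∀ x : Fin n → ℝ, BddAbove (Set.range fun k => x ⬝ᵥ X k *ᵥ x)) :
    ∃ Y : Matrix (Fin n) (Fin n) ℝ, Tendsto X atTop (𝓝 Y) := by
  choose q hq using fun x => (⟨_, tendsto_atTop_ciSup (hmono x) (hbdd x)⟩ :
    ∃ l, Tendsto (fun k => x ⬝ᵥ X k *ᵥ x) atTop (𝓝 l))
  refine ⟨Matrix.of fun i j => 1 / 4 * (q (Pi.single i 1 + Pi.single j 1)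
    - q (Pi.single i 1 + Pi.single j (-1))), ?_⟩
  refine tendsto_pi_nhds.mpr fun i => tendsto_pi_nhds.mpr fun j => ?_
  have := ((hq (Pi.single i 1 + Pi.single j 1)).sub
    (hq (Pi.single i 1 + Pi.single j (-1)))).const_mul (1 / 4)
  refine this.congr fun k => ?_
  rw [single_add_single_dotProduct (hX k), single_add_single_dotProduct (hX k)]
  ring

theorem posSemidef_of_tendsto {n : ℕ} {X : ℕ → Matrix (Fin n) (Fin n) ℝ}
    {Y : Matrix (Fin n) (Fin n) ℝ} (hX : ∀ k, (X k).PosSemidef) (h : Tendsto X atTop (𝓝 Y)) :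
    Y.PosSemidef := by
  refine Matrix.PosSemidef.of_dotProduct_mulVec_nonneg ?_ fun x => ?_
  · have h1 : Tendsto (fun k => (X k)ᵀ) atTop (𝓝 Yᵀ) :=
      (continuous_id.matrix_transpose.tendsto Y).comp h
    have h2 : Yᵀ = Y := tendsto_nhds_unique h1
      (h.congr fun k => (transpose_eq_of_posSemidef (hX k)).symm)
    rwa [Matrix.IsHermitian, Matrix.conjTranspose_eq_transpose_of_trivial]
  · have h1 : Tendsto (fun k => x ⬝ᵥ X k *ᵥ x) atTop (𝓝 (x ⬝ᵥ Y *ᵥ x)) :=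
      ((continuous_const.dotProduct
        (continuous_id.matrix_mulVec continuous_const)).tendsto Y).comp h
    rw [star_trivial]
    exact ge_of_tendsto' h1 fun k => dotProduct_mulVec_nonneg_of_posSemidef (hX k) x

/-! ### Convergence of the local Kalman filters -/

/-- One step of the prior covariance recursion with an arbitrary, possibly suboptimal, gain `L`:
`(A - L C) P (A - L C)ᵀ + L R Lᵀ + Q`. -/
noncomputable def System.gainStep {n M : ℕ} (s : System n M) (m : Fin M)
    (L : Matrix (Fin n) (Fin (s.dim m)) ℝ) (P : Matrix (Fin n) (Fin n) ℝ) : Matrix (Fin n) (Fin n) ℝ :=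
  (s.A - L * s.C m) * P * (s.A - L * s.C m)ᵀ + (L * s.R m * Lᵀ + s.Q)

/-- The Kalman gain `A P Cᵀ (C P Cᵀ + R)⁻¹`. -/
noncomputable def System.gain {n M : ℕ} (s : System n M) (m : Fin M)
    (P : Matrix (Fin n) (Fin n) ℝ) : Matrix (Fin n) (Fin (s.dim m)) ℝ :=
  s.A * P * (s.C m)ᵀ * (s.C m * P * (s.C m)ᵀ + s.R m)⁻¹

section Riccati

variable {n M : ℕ} {s : System n M} (m : Fin M)

theorem posDef_innovation (hs : s.Admissible) {P : Matrix (Fin n) (Fin n) ℝ}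
    (hP : P.PosSemidef) : (s.C m * P * (s.C m)ᵀ + s.R m).PosDef :=
  (hs.posDef_R m).posSemidef_add (posSemidef_conj _ hP)

/-- Completion of squares: the loss of a gain `L` against the Kalman gain. -/
theorem gainStep_sub_eq (hs : s.Admissible) {P : Matrix (Fin n) (Fin n) ℝ} (hP : P.PosSemidef)
    (L : Matrix (Fin n) (Fin (s.dim m)) ℝ) :
    s.gainStep m L P - s.f (s.measUpdate m P)
      = (L - s.gain m P) * (s.C m * P * (s.C m)ᵀ + s.R m) * (L - s.gain m P)ᵀ := by
  have hS := posDef_innovation m hs hP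
  have hPt := transpose_eq_of_posSemidef hP
  have hSt := transpose_eq_of_posSemidef hS.posSemidef
  set S := s.C m * P * (s.C m)ᵀ + s.R m with hSdef
  have hR : s.R m = S - s.C m * P * (s.C m)ᵀ := by rw [hSdef]; abel
  have hdet : IsUnit S.det := (Matrix.isUnit_iff_isUnit_det _).mp hS.isUnit
  have h1 : S * S⁻¹ = 1 := Matrix.mul_nonsing_inv _ hdet
  have h2 : S⁻¹ * S = 1 := Matrix.nonsing_inv_mul _ hdet
  have h3 : S⁻¹ᵀ = S⁻¹ := by rw [Matrix.transpose_nonsing_inv, hSt]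
  have hK : s.gain m P = s.A * P * (s.C m)ᵀ * S⁻¹ := rfl
  have hU : s.measUpdate m P = P - P * (s.C m)ᵀ * S⁻¹ * s.C m * P := rfl
  have hKS : s.gain m P * S = s.A * P * (s.C m)ᵀ := by
    rw [hK, Matrix.mul_assoc, h2, Matrix.mul_one]
  have hSK : S * (s.gain m P)ᵀ = s.C m * P * s.Aᵀ := by
    rw [hK]
    simp only [Matrix.transpose_mul, Matrix.transpose_transpose, hPt, h3]
    rw [← Matrix.mul_assoc, h1, Matrix.one_mul, Matrix.mul_assoc]
  have hKSK : s.gain m P * S * (s.gain m P)ᵀ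
      = s.A * P * (s.C m)ᵀ * S⁻¹ * (s.C m * P * s.Aᵀ) := by
    rw [Matrix.mul_assoc, hSK, hK]
  have hR' : (L - s.gain m P) * S * (L - s.gain m P)ᵀ
      = L * S * Lᵀ - L * (s.C m * P * s.Aᵀ) - s.A * P * (s.C m)ᵀ * Lᵀ
        + s.A * P * (s.C m)ᵀ * S⁻¹ * (s.C m * P * s.Aᵀ) := by
    rw [Matrix.transpose_sub, Matrix.sub_mul, Matrix.mul_sub, Matrix.sub_mul, Matrix.sub_mul,
      hKSK, hKS, Matrix.mul_assoc L S (s.gain m P)ᵀ, hSK]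
    abel
  rw [hR', System.gainStep, System.f, hU, hR]
  simp only [Matrix.sub_mul, Matrix.mul_sub, Matrix.transpose_sub, Matrix.transpose_mul,
    Matrix.mul_assoc]
  abel

theorem gainStep_gain (hs : s.Admissible) {P : Matrix (Fin n) (Fin n) ℝ} (hP : P.PosSemidef) :
    s.gainStep m (s.gain m P) P = s.f (s.measUpdate m P) := by
  have := gainStep_sub_eq m hs hP (s.gain m P)
  rwa [sub_self, Matrix.zero_mul, Matrix.zero_mul, sub_eq_zero] at this

/-- The Kalman gain is optimal. -/
theorem riccati_le_gainStep (hs : s.Admissible) {P : Matrix (Fin n) (Fin n) ℝ}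
    (hP : P.PosSemidef) (L : Matrix (Fin n) (Fin (s.dim m)) ℝ) :
    s.f (s.measUpdate m P) ≤ s.gainStep m L P := by
  rw [Matrix.le_iff, gainStep_sub_eq m hs hP L]
  exact posSemidef_conj _ (posDef_innovation m hs hP).posSemidef

theorem conj_le_conj {p : ℕ} (B : Matrix (Fin p) (Fin n) ℝ) {X Y : Matrix (Fin n) (Fin n) ℝ}
    (h : X ≤ Y) : B * X * Bᵀ ≤ B * Y * Bᵀ := by
  rw [Matrix.le_iff] at h ⊢
  rw [← Matrix.sub_mul, ← Matrix.mul_sub]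
  exact posSemidef_conj _ h

theorem gainStep_mono (L : Matrix (Fin n) (Fin (s.dim m)) ℝ) {X Y : Matrix (Fin n) (Fin n) ℝ}
    (h : X ≤ Y) : s.gainStep m L X ≤ s.gainStep m L Y :=
  add_le_add_left (conj_le_conj _ h) _

theorem posSemidef_gainStep (hs : s.Admissible) (L : Matrix (Fin n) (Fin (s.dim m)) ℝ)
    {X : Matrix (Fin n) (Fin n) ℝ} (hX : X.PosSemidef) : (s.gainStep m L X).PosSemidef :=
  (posSemidef_conj _ hX).add ((posSemidef_conj _ (hs.posDef_R m).posSemidef).add hs.posSemidef_Q)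

theorem posSemidef_riccati (hs : s.Admissible) {P : Matrix (Fin n) (Fin n) ℝ}
    (hP : P.PosSemidef) : (s.f (s.measUpdate m P)).PosSemidef := by
  rw [← gainStep_gain m hs hP]
  exact posSemidef_gainStep m hs _ hP

theorem riccati_mono (hs : s.Admissible) {X Y : Matrix (Fin n) (Fin n) ℝ} (hX : X.PosSemidef)
    (hY : Y.PosSemidef) (h : X ≤ Y) : s.f (s.measUpdate m X) ≤ s.f (s.measUpdate m Y) := by
  rw [← gainStep_gain m hs hY]
  exact (riccati_le_gainStep m hs hX _).trans (gainStep_mono m _ h)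

/-- Joseph's form `(1 - K C) P (1 - K C)ᵀ + K R Kᵀ` of the measurement update, with the filter gain
`K = P Cᵀ (C P Cᵀ + R)⁻¹`, shows that it preserves positive semidefiniteness. -/
theorem posSemidef_measUpdate (hs : s.Admissible) {P : Matrix (Fin n) (Fin n) ℝ}
    (hP : P.PosSemidef) : (s.measUpdate m P).PosSemidef := by
  have hS := posDef_innovation m hs hP
  have hPt := transpose_eq_of_posSemidef hP
  have hdet := (Matrix.isUnit_iff_isUnit_det _).mp hS.isUnit
  have hSt := transpose_eq_of_posSemidef hS.posSemidef
  set S := s.C m * P * (s.C m)ᵀ + s.R m with hSdef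
  have h3 : S⁻¹ᵀ = S⁻¹ := by rw [Matrix.transpose_nonsing_inv, hSt]
  have h1 : S * S⁻¹ = 1 := Matrix.mul_nonsing_inv _ hdet
  set K := P * (s.C m)ᵀ * S⁻¹ with hK
  have hR : s.R m = S - s.C m * P * (s.C m)ᵀ := by rw [hSdef]; abel
  have hSK : S * Kᵀ = s.C m * P := by
    rw [hK]
    simp only [Matrix.transpose_mul, Matrix.transpose_transpose, hPt, h3]
    rw [← Matrix.mul_assoc, h1, Matrix.one_mul]
  have hKt : K * s.C m * P = P * (s.C m)ᵀ * Kᵀ := by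
    rw [Matrix.mul_assoc, ← hSK, ← Matrix.mul_assoc, hK,
      Matrix.mul_assoc _ S⁻¹ S, Matrix.nonsing_inv_mul _ hdet, Matrix.mul_one]
  have key : s.measUpdate m P = (1 - K * s.C m) * P * (1 - K * s.C m)ᵀ + K * s.R m * Kᵀ := by
    have h0 : s.measUpdate m P = P - K * s.C m * P := rfl
    have h4 : K * S * Kᵀ = K * s.C m * P := by rw [Matrix.mul_assoc, hSK, ← Matrix.mul_assoc]
    have h5 : K * s.R m * Kᵀ = K * s.C m * P - K * s.C m * (P * ((s.C m)ᵀ * Kᵀ)) := by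
      rw [hR, Matrix.mul_sub, Matrix.sub_mul, h4]
      simp only [Matrix.mul_assoc]
    have h6 : P * ((s.C m)ᵀ * Kᵀ) = K * (s.C m * P) := by
      rw [← Matrix.mul_assoc, ← hKt, Matrix.mul_assoc]
    rw [h5, h0, Matrix.transpose_sub, Matrix.transpose_one, Matrix.transpose_mul, Matrix.sub_mul,
      Matrix.one_mul, Matrix.mul_sub, Matrix.mul_one, Matrix.sub_mul]
    simp only [Matrix.mul_assoc, h6]
    abel
  rw [key]
  exact (posSemidef_conj _ hP).add (posSemidef_conj _ (hs.posDef_R m).posSemidef)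

/-- The prior covariances of the local filter of sensor `m`, started at `X`. -/
noncomputable def System.riccatiOrbit (s : System n M) (m : Fin M)
    (X : Matrix (Fin n) (Fin n) ℝ) (k : ℕ) : Matrix (Fin n) (Fin n) ℝ :=
  (fun P => s.f (s.measUpdate m P))^[k] X

theorem riccatiOrbit_succ (X : Matrix (Fin n) (Fin n) ℝ) (k : ℕ) :
    s.riccatiOrbit m X (k + 1) = s.f (s.measUpdate m (s.riccatiOrbit m X k)) :=
  Function.iterate_succ_apply' _ _ _

theorem localPrior_eq_riccatiOrbit (k : ℕ) : s.localPrior m k = s.riccatiOrbit m s.Sigma0 k := by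
  induction k with
  | zero => rfl
  | succ k ih => rw [riccatiOrbit_succ, System.localPrior, ih]

theorem posSemidef_riccatiOrbit (hs : s.Admissible) {X : Matrix (Fin n) (Fin n) ℝ}
    (hX : X.PosSemidef) (k : ℕ) : (s.riccatiOrbit m X k).PosSemidef := by
  induction k with
  | zero => exact hX
  | succ k ih => rw [riccatiOrbit_succ]; exact posSemidef_riccati m hs ih

theorem riccatiOrbit_mono (hs : s.Admissible) {X Y : Matrix (Fin n) (Fin n) ℝ}
    (hX : X.PosSemidef) (hY : Y.PosSemidef) (h : X ≤ Y) (k : ℕ) :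
    s.riccatiOrbit m X k ≤ s.riccatiOrbit m Y k := by
  induction k with
  | zero => exact h
  | succ k ih =>
    rw [riccatiOrbit_succ, riccatiOrbit_succ]
    exact riccati_mono m hs (posSemidef_riccatiOrbit m hs hX k)
      (posSemidef_riccatiOrbit m hs hY k) ih

theorem dotProduct_mulVec_mono {X Y : Matrix (Fin n) (Fin n) ℝ} (h : X ≤ Y) (x : Fin n → ℝ) :
    x ⬝ᵥ X *ᵥ x ≤ x ⬝ᵥ Y *ᵥ x := by
  have := dotProduct_mulVec_nonneg_of_posSemidef (Matrix.le_iff.mp h) x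
  rw [Matrix.sub_mulVec, dotProduct_sub] at this
  linarith

theorem monotone_riccatiOrbit_zero (hs : s.Admissible) : Monotone (s.riccatiOrbit m 0) := by
  refine monotone_nat_of_le_succ fun k => ?_
  have h0 : (0 : Matrix (Fin n) (Fin n) ℝ) ≤ s.f (s.measUpdate m 0) := by
    rw [Matrix.le_iff, sub_zero]
    exact posSemidef_riccati m hs Matrix.PosSemidef.zero
  exact riccatiOrbit_mono m hs Matrix.PosSemidef.zero
    (posSemidef_riccati m hs Matrix.PosSemidef.zero) h0 k

/-- Detectability bounds the Riccati iterates: a gain `L` with `A - L C` stable has bounded error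
covariance, and the Kalman filter does at least as well. -/
theorem bddAbove_riccatiOrbit_zero (hs : s.Admissible) (x : Fin n → ℝ) :
    BddAbove (Set.range fun k => x ⬝ᵥ s.riccatiOrbit m 0 k *ᵥ x) := by
  obtain ⟨L, hL⟩ := hs.detectable m
  obtain ⟨C, r, hC, hr0, hr1, hb⟩ := hL.exists_abs_pow_apply_le
  set F := s.A - L * s.C m with hF
  set W := L * s.R m * Lᵀ + s.Q with hW
  set c := ∑ i, |x i| with hc
  have hr2 : r ^ 2 < 1 := pow_lt_one₀ hr0.le hr1 two_ne_zero
  have hle : ∀ k, s.riccatiOrbit m 0 k ≤ ∑ j ∈ Finset.range k, F ^ j * W * (F ^ j)ᵀ := by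
    intro k
    induction k with
    | zero => exact le_rfl
    | succ k ih =>
      rw [riccatiOrbit_succ]
      refine (riccati_le_gainStep m hs
        (posSemidef_riccatiOrbit m hs Matrix.PosSemidef.zero k) L).trans
        ((gainStep_mono m L ih).trans (le_of_eq ?_))
      rw [System.gainStep, ← hF, ← hW, Finset.sum_range_succ', Matrix.mul_sum, Matrix.sum_mul]
      congr 1
      · refine Finset.sum_congr rfl fun j _ => ?_
        rw [pow_succ', Matrix.transpose_mul]
        simp only [Matrix.mul_assoc]
      · simp
  have hcx : ∀ i, |x i| ≤ c := fun i =>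
    Finset.single_le_sum (f := fun j => |x j|) (fun j _ => abs_nonneg _) (Finset.mem_univ i)
  have hc0 : 0 ≤ c := Finset.sum_nonneg fun j _ => abs_nonneg _
  have hterm : ∀ j, x ⬝ᵥ (F ^ j * W * (F ^ j)ᵀ) *ᵥ x
      ≤ (c * (n * C)) ^ 2 * absSum W * (r ^ 2) ^ j := by
    intro j
    have hy : ∀ i, |(x ᵥ* F ^ j) i| ≤ c * (C * r ^ j) := by
      intro i
      have h1 : (x ᵥ* F ^ j) i = ∑ l, x l * (F ^ j) l i := rfl
      rw [h1, hc, Finset.sum_mul]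
      refine (Finset.abs_sum_le_sum_abs _ _).trans (Finset.sum_le_sum fun l _ => ?_)
      rw [abs_mul]
      exact mul_le_mul_of_nonneg_left (hb j l i) (abs_nonneg _)
    rw [dotProduct_conj_mulVec]
    refine (le_abs_self _).trans ((abs_sum_mul_mul_le W (by positivity) hy hy).trans ?_)
    rcases Nat.eq_zero_or_pos n with rfl | hn
    · simp [absSum]
    · have h1 : (1 : ℝ) ≤ n := by exact_mod_cast hn
      have h2 : (c * (C * r ^ j)) ^ 2 = (c * C) ^ 2 * (r ^ 2) ^ j := by ring
      have h3 : (c * C) ^ 2 ≤ (c * (n * C)) ^ 2 := by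
        gcongr
        exact le_mul_of_one_le_left hC h1
      rw [h2, mul_right_comm]
      have := absSum_nonneg W
      gcongr
  refine ⟨(c * (n * C)) ^ 2 * absSum W * (1 - r ^ 2)⁻¹, ?_⟩
  rintro _ ⟨k, rfl⟩
  refine (dotProduct_mulVec_mono (hle k) x).trans ?_
  rw [Matrix.sum_mulVec, dotProduct_sum]
  refine (Finset.sum_le_sum fun j _ => hterm j).trans ?_
  rw [← Finset.mul_sum]
  have h0 := absSum_nonneg W
  gcongr
  rw [← tsum_geometric_of_lt_one (by positivity) hr2]
  exact (summable_geometric_of_lt_one (by positivity) hr2).sum_le_tsum _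
    fun j _ => by positivity

theorem continuousAt_measUpdate (hs : s.Admissible) {P : Matrix (Fin n) (Fin n) ℝ}
    (hP : P.PosSemidef) : ContinuousAt (s.measUpdate m) P := by
  have hS : ContinuousAt (fun X : Matrix (Fin n) (Fin n) ℝ =>
      (s.C m * X * (s.C m)ᵀ + s.R m)⁻¹) P := by
    have hc : Continuous fun X : Matrix (Fin n) (Fin n) ℝ => s.C m * X * (s.C m)ᵀ + s.R m := by
      fun_prop
    have hdet := (Matrix.isUnit_iff_isUnit_det _).mp (posDef_innovation m hs hP).isUnit
    refine ContinuousAt.comp (g := fun Y => Y⁻¹) ?_ hc.continuousAt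
    exact continuousAt_matrix_inv _ (by
      rw [Ring.inverse_eq_inv']
      exact continuousAt_inv₀ hdet.ne_zero)
  unfold System.measUpdate
  have h1 : ContinuousAt (fun X : Matrix (Fin n) (Fin n) ℝ => X * (s.C m)ᵀ) P := by fun_prop
  have h2 : ContinuousAt (fun X : Matrix (Fin n) (Fin n) ℝ => s.C m * X) P := by fun_prop
  have hmul : ∀ {a b d : ℕ} {f : Matrix (Fin n) (Fin n) ℝ → Matrix (Fin a) (Fin b) ℝ}
      {g : Matrix (Fin n) (Fin n) ℝ → Matrix (Fin b) (Fin d) ℝ}, ContinuousAt f P →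
      ContinuousAt g P → ContinuousAt (fun X => f X * g X) P := by
    intro a b d f g hf hg
    exact (Continuous.matrix_mul continuous_fst continuous_snd).continuousAt.comp
      (f := fun X => (f X, g X)) (hf.prodMk hg)
  have h3 := hmul (hmul h1 hS) h2
  simp only [← Matrix.mul_assoc] at h3
  exact continuousAt_id.sub h3

theorem continuous_f : Continuous s.f := by
  unfold System.f
  fun_prop

/-- The process noise excites every left eigenvector `u + i v` of `A` outside the open unit disc:
one that `Q`, hence `Q^{1/2}`, annihilates would be a left eigenvector of `A + Q^{1/2} K` for every
feedback `K`. -/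
theorem noise_pos_of_isLeftEigenpair (hs : s.Admissible) {a b : ℝ} {u v : Fin n → ℝ}
    (h : IsLeftEigenpair s.A a b u v) (hab : 1 ≤ a ^ 2 + b ^ 2) :
    0 < u ⬝ᵥ s.Q *ᵥ u + v ⬝ᵥ s.Q *ᵥ v := by
  have hu := dotProduct_mulVec_nonneg_of_posSemidef hs.posSemidef_Q u
  have hv := dotProduct_mulVec_nonneg_of_posSemidef hs.posSemidef_Q v
  by_contra hcon
  have hu0 : u ⬝ᵥ s.Q *ᵥ u = 0 := by linarith
  have hv0 : v ⬝ᵥ s.Q *ᵥ v = 0 := by linarith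
  have hsq : CFC.sqrt s.Q * CFC.sqrt s.Q = s.Q :=
    CFC.sqrt_mul_sqrt_self s.Q (Matrix.nonneg_iff_posSemidef.mpr hs.posSemidef_Q)
  have hst : (CFC.sqrt s.Q)ᵀ = CFC.sqrt s.Q :=
    transpose_eq_of_posSemidef (Matrix.nonneg_iff_posSemidef.mp (CFC.sqrt_nonneg s.Q))
  have hker : ∀ w : Fin n → ℝ, w ⬝ᵥ s.Q *ᵥ w = 0 → w ᵥ* CFC.sqrt s.Q = 0 := by
    intro w hw
    rw [← hsq, ← Matrix.mulVec_mulVec, Matrix.dotProduct_mulVec] at hw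
    nth_rewrite 2 [← hst] at hw
    rwa [Matrix.mulVec_transpose, dotProduct_self_eq_zero] at hw
  obtain ⟨K, hK⟩ := hs.stabilizable
  have h' : IsLeftEigenpair (s.A + CFC.sqrt s.Q * K) a b u v := by
    refine ⟨?_, ?_, h.ne_zero⟩
    · rw [Matrix.vecMul_add, ← Matrix.vecMul_vecMul, hker u hu0, Matrix.zero_vecMul, add_zero, h.re]
    · rw [Matrix.vecMul_add, ← Matrix.vecMul_vecMul, hker v hv0, Matrix.zero_vecMul, add_zero, h.im]
  exact absurd (h'.sq_add_sq_lt_one hK) (not_lt.mpr hab)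

/-- A positive semidefinite solution of the algebraic Riccati equation is stabilizing. -/
theorem isStable_of_riccati_fixed (hs : s.Admissible) {P : Matrix (Fin n) (Fin n) ℝ}
    (hP : P.PosSemidef) (hfix : s.f (s.measUpdate m P) = P) :
    IsStable (s.A - s.gain m P * s.C m) := by
  by_contra hcon
  obtain ⟨a, b, u, v, h, hab⟩ := exists_isLeftEigenpair hcon
  set L := s.gain m P with hL
  have hPeq : (s.A - L * s.C m) * P * (s.A - L * s.C m)ᵀ + (L * s.R m * Lᵀ + s.Q) = P :=
    (gainStep_gain m hs hP).trans hfix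
  have h1 := h.conj_add_conj (transpose_eq_of_posSemidef hP)
  have hu : u ⬝ᵥ P *ᵥ u = u ⬝ᵥ ((s.A - L * s.C m) * P * (s.A - L * s.C m)ᵀ) *ᵥ u
      + (u ⬝ᵥ (L * s.R m * Lᵀ) *ᵥ u + u ⬝ᵥ s.Q *ᵥ u) := by
    nth_rewrite 1 [← hPeq]
    simp only [Matrix.add_mulVec, dotProduct_add]
  have hv : v ⬝ᵥ P *ᵥ v = v ⬝ᵥ ((s.A - L * s.C m) * P * (s.A - L * s.C m)ᵀ) *ᵥ v
      + (v ⬝ᵥ (L * s.R m * Lᵀ) *ᵥ v + v ⬝ᵥ s.Q *ᵥ v) := by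
    nth_rewrite 1 [← hPeq]
    simp only [Matrix.add_mulVec, dotProduct_add]
  have hRu := dotProduct_mulVec_nonneg_of_posSemidef
    (posSemidef_conj L (hs.posDef_R m).posSemidef) u
  have hRv := dotProduct_mulVec_nonneg_of_posSemidef
    (posSemidef_conj L (hs.posDef_R m).posSemidef) v
  have hQu := dotProduct_mulVec_nonneg_of_posSemidef hs.posSemidef_Q u
  have hQv := dotProduct_mulVec_nonneg_of_posSemidef hs.posSemidef_Q v
  have hPu := dotProduct_mulVec_nonneg_of_posSemidef hP u
  have hPv := dotProduct_mulVec_nonneg_of_posSemidef hP v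
  have hge : u ⬝ᵥ P *ᵥ u + v ⬝ᵥ P *ᵥ v ≤ (a ^ 2 + b ^ 2) * (u ⬝ᵥ P *ᵥ u + v ⬝ᵥ P *ᵥ v) :=
    le_mul_of_one_le_left (by linarith) hab
  -- the noise terms vanish on the eigenvector, so the gain does not act on it
  have hker : ∀ w : Fin n → ℝ, w ⬝ᵥ (L * s.R m * Lᵀ) *ᵥ w = 0 → w ᵥ* L = 0 := by
    intro w hw
    rw [dotProduct_conj_mulVec] at hw
    by_contra hne
    have := (hs.posDef_R m).dotProduct_mulVec_pos hne
    rw [star_trivial] at this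
    exact this.ne' hw
  have hLu := hker u (by linarith)
  have hLv := hker v (by linarith)
  have h' : IsLeftEigenpair s.A a b u v := by
    refine ⟨?_, ?_, h.ne_zero⟩
    · rw [← h.re, Matrix.vecMul_sub, ← Matrix.vecMul_vecMul, hLu, Matrix.zero_vecMul, sub_zero]
    · rw [← h.im, Matrix.vecMul_sub, ← Matrix.vecMul_vecMul, hLv, Matrix.zero_vecMul, sub_zero]
  have := noise_pos_of_isLeftEigenpair hs h' hab
  linarith

/-- The Riccati iterates converge from every positive semidefinite initial covariance: they lie
between the increasing iterates from `0`, with limit `P`, and the iterates with the constant gain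
of `P`, which is stabilizing. -/
theorem exists_tendsto_riccatiOrbit (hs : s.Admissible) {X : Matrix (Fin n) (Fin n) ℝ}
    (hX : X.PosSemidef) :
    ∃ P : Matrix (Fin n) (Fin n) ℝ, P.PosSemidef ∧
      Tendsto (s.riccatiOrbit m X) atTop (𝓝 P) := by
  have hO := posSemidef_riccatiOrbit m hs (Matrix.PosSemidef.zero (n := Fin n) (R := ℝ))
  obtain ⟨P, hlim⟩ := exists_tendsto_of_monotone
    (fun k => transpose_eq_of_posSemidef (hO k))
    (fun x _ _ hij => dotProduct_mulVec_mono (monotone_riccatiOrbit_zero m hs hij) x)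
    (bddAbove_riccatiOrbit_zero m hs)
  have hP : P.PosSemidef := posSemidef_of_tendsto hO hlim
  have hfix : s.f (s.measUpdate m P) = P := by
    have h1 : Tendsto (fun k => s.riccatiOrbit m 0 (k + 1)) atTop
        (𝓝 (s.f (s.measUpdate m P))) := by
      simp_rw [riccatiOrbit_succ]
      exact (continuous_f.continuousAt.comp (continuousAt_measUpdate m hs hP)).tendsto.comp hlim
    exact tendsto_nhds_unique h1 (hlim.comp (tendsto_add_atTop_nat 1))
  refine ⟨P, hP, ?_⟩
  obtain ⟨C, r, hC, hr0, hr1, hb⟩ :=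
    (isStable_of_riccati_fixed m hs hP hfix).exists_abs_pow_apply_le
  set L := s.gain m P with hL
  set F := s.A - L * s.C m with hF
  have hup : ∀ k, s.riccatiOrbit m X k ≤ P + F ^ k * (X - P) * (F ^ k)ᵀ := by
    intro k
    induction k with
    | zero => exact le_of_eq (by simp [System.riccatiOrbit])
    | succ k ih =>
      rw [riccatiOrbit_succ]
      refine (riccati_le_gainStep m hs (posSemidef_riccatiOrbit m hs hX k) L).trans
        ((gainStep_mono m L ih).trans (le_of_eq ?_))
      have h1 : F * P * Fᵀ + (L * s.R m * Lᵀ + s.Q) = P := (gainStep_gain m hs hP).trans hfix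
      have h2 : s.gainStep m L (P + F ^ k * (X - P) * (F ^ k)ᵀ)
          = F * P * Fᵀ + (L * s.R m * Lᵀ + s.Q) + F * (F ^ k * (X - P) * (F ^ k)ᵀ) * Fᵀ := by
        rw [System.gainStep, ← hF, Matrix.mul_add, Matrix.add_mul]
        abel
      rw [h2, h1, pow_succ', Matrix.transpose_mul]
      simp only [Matrix.mul_assoc]
  have hlow : ∀ k, s.riccatiOrbit m 0 k ≤ s.riccatiOrbit m X k := fun k =>
    riccatiOrbit_mono m hs Matrix.PosSemidef.zero hX
      (by rw [Matrix.le_iff, sub_zero]; exact hX) k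
  have hzero : Tendsto (fun k => F ^ k * (X - P) * (F ^ k)ᵀ) atTop (𝓝 0) := by
    refine tendsto_pi_nhds.mpr fun i => tendsto_pi_nhds.mpr fun j => ?_
    have hr : Tendsto (fun k : ℕ => (C * r ^ k) ^ 2 * absSum (X - P)) atTop (𝓝 0) := by
      have := ((((tendsto_pow_atTop_nhds_zero_of_lt_one hr0.le hr1).const_mul C).pow 2).mul_const
        (absSum (X - P)))
      simpa using this
    exact squeeze_zero_norm
      (fun k => abs_conj_apply_le (by positivity) (hb k) i j) hr
  have hform : ∀ x : Fin n → ℝ, Continuous fun Y : Matrix (Fin n) (Fin n) ℝ => x ⬝ᵥ Y *ᵥ x :=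
    fun x => continuous_const.dotProduct (continuous_id.matrix_mulVec continuous_const)
  have hupper : Tendsto (fun k => P + F ^ k * (X - P) * (F ^ k)ᵀ) atTop (𝓝 P) := by
    simpa using hzero.const_add P
  exact tendsto_of_tendsto_dotProduct
    (fun k => transpose_eq_of_posSemidef (posSemidef_riccatiOrbit m hs hX k))
    (transpose_eq_of_posSemidef hP) fun x =>
    tendsto_of_tendsto_of_tendsto_of_le_of_le
      (((hform x).tendsto P).comp hlim) (((hform x).tendsto P).comp hupper)
      (fun k => dotProduct_mulVec_mono (hlow k) x) (fun k => dotProduct_mulVec_mono (hup k) x)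

theorem exists_tendsto_localPost (hs : s.Admissible) :
    ∃ Pbar : Matrix (Fin n) (Fin n) ℝ, Pbar.PosSemidef ∧
      Tendsto (s.localPost m) atTop (𝓝 Pbar) := by
  obtain ⟨P, hP, hlim⟩ := exists_tendsto_riccatiOrbit m hs hs.posSemidef_Sigma0
  refine ⟨s.measUpdate m P, posSemidef_measUpdate m hs hP, ?_⟩
  have := (continuousAt_measUpdate m hs hP).tendsto.comp hlim
  refine this.congr fun k => ?_
  rw [System.localPost, localPrior_eq_riccatiOrbit]
  rfl

end Riccati

/-! ### The average cost Bellman equation of a controlled process with resets -/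

/-- A controlled process: under the action `a`, the state `x` moves to `r a` with probability
`p a` and to `f x` otherwise. An action `a` costs `E a`, and arriving at a state `y` costs `c y`. -/
structure ResetProcess (X A : Type*) where
  /-- motion without a reset -/
  f : X → X
  /-- state after a reset -/
  r : A → X
  /-- cost of arriving at a state -/
  c : X → ℝ
  /-- probability of a reset -/
  p : A → ℝ
  /-- cost of an action -/
  E : A → ℝ
  c_nonneg : ∀ x, 0 ≤ c x
  p_nonneg : ∀ a, 0 ≤ p a
  p_le_one : ∀ a, p a ≤ 1
  E_nonneg : ∀ a, 0 ≤ E a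

namespace ResetProcess

variable {X A : Type*} (D : ResetProcess X A)

/-- Expected cost of the action `a` at the state `x`, when the discounted terminal cost is
`α * V`. -/
def q (α : ℝ) (V : X → ℝ) (x : X) (a : A) : ℝ :=
  D.E a + D.p a * (D.c (D.r a) + α * V (D.r a)) + (1 - D.p a) * (D.c (D.f x) + α * V (D.f x))

theorem q_mono {α : ℝ} (hα : 0 ≤ α) {V W : X → ℝ} (h : ∀ x, V x ≤ W x) (x : X) (a : A) :
    D.q α V x a ≤ D.q α W x a := by
  have h1 := D.p_nonneg a
  have h2 : 0 ≤ 1 - D.p a := sub_nonneg.mpr (D.p_le_one a)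
  unfold q
  gcongr <;> exact h _

theorem tendsto_q {ι : Type*} {l : Filter ι} {α : ι → ℝ} {α' : ℝ} {V : ι → X → ℝ} {V' : X → ℝ}
    (hα : Tendsto α l (𝓝 α')) (hV : ∀ x, Tendsto (fun i => V i x) l (𝓝 (V' x))) (x : X) (a : A) :
    Tendsto (fun i => D.q (α i) (V i) x a) l (𝓝 (D.q α' V' x a)) :=
  (((hα.mul (hV _)).const_add _).const_mul _ |>.const_add _).add
    (((hα.mul (hV _)).const_add _).const_mul _)

theorem q_nonneg {α : ℝ} (hα : 0 ≤ α) {V : X → ℝ} (hV : ∀ x, 0 ≤ V x) (x : X) (a : A) :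
    0 ≤ D.q α V x a := by
  have h1 := D.p_nonneg a
  have h2 : 0 ≤ 1 - D.p a := sub_nonneg.mpr (D.p_le_one a)
  have h3 := D.c_nonneg (D.r a)
  have h4 := D.c_nonneg (D.f x)
  have h5 := hV (D.r a)
  have h6 := hV (D.f x)
  have h7 := D.E_nonneg a
  unfold q
  positivity

variable [Fintype A] [Nonempty A]

/-- The Bellman operator with discount factor `α`. -/
noncomputable def T (α : ℝ) (V : X → ℝ) (x : X) : ℝ :=
  Finset.univ.inf' Finset.univ_nonempty (D.q α V x)

theorem T_le_q (α : ℝ) (V : X → ℝ) (x : X) (a : A) : D.T α V x ≤ D.q α V x a :=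
  Finset.inf'_le _ (Finset.mem_univ a)

theorem exists_T_eq_q (α : ℝ) (V : X → ℝ) (x : X) : ∃ a, D.T α V x = D.q α V x a := by
  obtain ⟨a, -, h⟩ := Finset.exists_mem_eq_inf' Finset.univ_nonempty (D.q α V x)
  exact ⟨a, h⟩

theorem T_mono {α : ℝ} (hα : 0 ≤ α) {V W : X → ℝ} (h : ∀ x, V x ≤ W x) (x : X) :
    D.T α V x ≤ D.T α W x := by
  obtain ⟨a, ha⟩ := D.exists_T_eq_q α W x
  exact (D.T_le_q α V x a).trans ((D.q_mono hα h x a).trans_eq ha.symm)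

theorem tendsto_T {ι : Type*} {l : Filter ι} {α : ι → ℝ} {α' : ℝ} {V : ι → X → ℝ} {V' : X → ℝ}
    (hα : Tendsto α l (𝓝 α')) (hV : ∀ x, Tendsto (fun i => V i x) l (𝓝 (V' x))) (x : X) :
    Tendsto (fun i => D.T (α i) (V i) x) l (𝓝 (D.T α' V' x)) :=
  Tendsto.finset_inf'_nhds_apply Finset.univ_nonempty fun a _ => D.tendsto_q hα hV x a

/-- `V` is the discounted value function: the limit of value iteration from `0`, a fixed point of
the Bellman operator and the least nonnegative supersolution. -/
structure IsValue (α : ℝ) (V : X → ℝ) : Prop where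
  tendsto : ∀ x, Tendsto (fun k => (D.T α)^[k] 0 x) atTop (𝓝 (V x))
  fixed : ∀ x, D.T α V x = V x
  nonneg : ∀ x, 0 ≤ V x
  le_of_T_le : ∀ W : X → ℝ, (∀ x, 0 ≤ W x) → (∀ x, D.T α W x ≤ W x) → ∀ x, V x ≤ W x

/-- A nonnegative supersolution `W` bounds the value iteration, which therefore converges. -/
theorem exists_isValue {α : ℝ} (hα : 0 ≤ α) {W : X → ℝ} (hW0 : ∀ x, 0 ≤ W x)
    (hW : ∀ x, D.T α W x ≤ W x) : ∃ V, D.IsValue α V := by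
  have hle : ∀ W : X → ℝ, (∀ x, 0 ≤ W x) → (∀ x, D.T α W x ≤ W x) →
      ∀ k x, (D.T α)^[k] 0 x ≤ W x := by
    intro W hW0 hW k
    induction k with
    | zero => exact hW0
    | succ k ih =>
      intro x
      rw [Function.iterate_succ_apply']
      exact (D.T_mono hα ih x).trans (hW x)
  have hmono : ∀ k x, (D.T α)^[k] 0 x ≤ (D.T α)^[k + 1] 0 x := by
    intro k
    induction k with
    | zero =>
      intro x
      obtain ⟨a, ha⟩ := D.exists_T_eq_q α 0 x
      simp only [Function.iterate_zero, Function.iterate_one, id, zero_add, ha]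
      exact D.q_nonneg hα (fun _ => le_rfl) x a
    | succ k ih =>
      intro x
      rw [Function.iterate_succ_apply', Function.iterate_succ_apply' _ (k + 1)]
      exact D.T_mono hα ih x
  have hlim : ∀ x, Tendsto (fun k => (D.T α)^[k] 0 x) atTop (𝓝 (⨆ k, (D.T α)^[k] 0 x)) :=
    fun x => tendsto_atTop_ciSup (monotone_nat_of_le_succ fun k => hmono k x)
      ⟨W x, by rintro _ ⟨k, rfl⟩; exact hle W hW0 hW k x⟩
  refine ⟨fun x => ⨆ k, (D.T α)^[k] 0 x, hlim, fun x => ?_, fun x => ?_, fun W' h0 h1 x => ?_⟩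
  · have h1 := D.tendsto_T (tendsto_const_nhds (x := α)) hlim x
    simp_rw [← Function.iterate_succ_apply' (D.T α)] at h1
    exact tendsto_nhds_unique h1 ((hlim x).comp (tendsto_add_atTop_nat 1))
  · exact ge_of_tendsto' (hlim x) fun k =>
      (monotone_nat_of_le_succ fun k => hmono k x) (Nat.zero_le k)
  · exact le_of_tendsto' (hlim x) fun k => hle W' h0 h1 k x

/-- The vanishing discount argument. If the value functions relative to a fixed state are bounded
pointwise, uniformly in the discount factor, then an ultrafilter limit of them solves the average
cost Bellman equation, since each state has only finitely many successors. -/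
theorem exists_bellman_of_bounds {V : ℝ → X → ℝ} {x₀ : X} {J : ℝ} {lo up : X → ℝ}
    (hV : ∀ α ∈ Set.Ioo (0 : ℝ) 1, D.IsValue α (V α))
    (hJ : ∀ α ∈ Set.Ioo (0 : ℝ) 1, (1 - α) * V α x₀ ≤ J)
    (hlo : ∀ α ∈ Set.Ioo (0 : ℝ) 1, ∀ x, lo x ≤ V α x - V α x₀)
    (hup : ∀ α ∈ Set.Ioo (0 : ℝ) 1, ∀ x, V α x - V α x₀ ≤ up x) :
    ∃ (ρ : ℝ) (h : X → ℝ), (∀ x, ρ + h x = D.T 1 h x) ∧ (∀ x, lo x ≤ h x) ∧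
      ∀ x, h x ≤ up x := by
  set U : Ultrafilter ℝ := Ultrafilter.of (𝓝[<] (1 : ℝ)) with hU
  have hUle : (U : Filter ℝ) ≤ 𝓝[<] (1 : ℝ) := Ultrafilter.of_le _
  have hmem : ∀ᶠ α in (U : Filter ℝ), α ∈ Set.Ioo (0 : ℝ) 1 :=
    hUle (Ioo_mem_nhdsLT one_pos)
  have hlimit : ∀ (g : ℝ → ℝ) (a b : ℝ), (∀ α ∈ Set.Ioo (0 : ℝ) 1, a ≤ g α ∧ g α ≤ b) →
      ∃ l ∈ Set.Icc a b, Tendsto g U (𝓝 l) := fun g a b hg =>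
    isCompact_Icc.ultrafilter_le_nhds' (U.map g)
      (Ultrafilter.mem_map.mpr (hmem.mono fun α hα => hg α hα))
  obtain ⟨ρ, -, hρ⟩ := hlimit (fun α => (1 - α) * V α x₀) 0 J fun α hα =>
    ⟨mul_nonneg (by linarith [hα.2]) ((hV α hα).nonneg x₀), hJ α hα⟩
  choose h hmemh hh using fun x => hlimit (fun α => V α x - V α x₀) (lo x) (up x) fun α hα =>
    ⟨hlo α hα x, hup α hα x⟩
  refine ⟨ρ, h, fun x => ?_, fun x => (hmemh x).1, fun x => (hmemh x).2⟩
  have hα : Tendsto (fun α : ℝ => α) U (𝓝 1) := hUle.trans nhdsWithin_le_nhds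
  have hT := D.tendsto_T hα hh x
  refine tendsto_nhds_unique ((hρ.add (hh x)).congr' ?_) hT
  filter_upwards [hmem] with α hα
  have hq : ∀ a, D.q α (fun x => V α x - V α x₀) x a = D.q α (V α) x a - α * V α x₀ := by
    intro a
    unfold q
    ring
  have : D.T α (fun x => V α x - V α x₀) x = D.T α (V α) x - α * V α x₀ := by
    apply le_antisymm
    · obtain ⟨a, ha⟩ := D.exists_T_eq_q α (V α) x
      rw [ha, ← hq]
      exact D.T_le_q _ _ _ _
    · obtain ⟨a, ha⟩ := D.exists_T_eq_q α (fun x => V α x - V α x₀) x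
      rw [ha, hq]
      exact sub_le_sub_right (D.T_le_q _ _ _ _) _
  rw [this, (hV α hα).fixed]
  ring

section Reset

variable {D} {a : A} {B : X → ℝ}

/-- `B` is a bound for the expected cost of repeating the action `a` until a reset. -/
structure IsResetBound (D : ResetProcess X A) (a : A) (B : X → ℝ) : Prop where
  nonneg : ∀ x, 0 ≤ B x
  step : ∀ x, D.E a + D.p a * D.c (D.r a) + (1 - D.p a) * (D.c (D.f x) + B (D.f x)) ≤ B x

variable {α : ℝ} {V : X → ℝ}

/-- The discounted value is finite: `B (r a) / (1 - α)` bounds the discounted total cost of all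
cycles that follow the reset at the end of the current one. -/
theorem IsResetBound.exists_isValue (hB : IsResetBound D a B) (hα : α ∈ Set.Ioo (0 : ℝ) 1) :
    ∃ V, D.IsValue α V ∧ (1 - α) * V (D.r a) ≤ 2 * B (D.r a) := by
  have h1 : 0 < 1 - α := by linarith [hα.2]
  have hBr := hB.nonneg (D.r a)
  set K := B (D.r a) / (1 - α) with hK
  have hK0 : 0 ≤ K := div_nonneg hBr h1.le
  have hKeq : (1 - α) * K = B (D.r a) := by rw [hK]; field_simp
  have hp := D.p_nonneg a
  have hp1 : 0 ≤ 1 - D.p a := sub_nonneg.mpr (D.p_le_one a)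
  have hW0 : ∀ x, 0 ≤ B x + K := fun x => add_nonneg (hB.nonneg x) hK0
  have hWT : ∀ x, D.T α (fun x => B x + K) x ≤ B x + K := by
    intro x
    refine (D.T_le_q _ _ x a).trans ?_
    have h2 := hB.step x
    have h3 : α * B (D.f x) ≤ B (D.f x) := mul_le_of_le_one_left (hB.nonneg _) hα.2.le
    have h4 : (1 - D.p a) * (α * B (D.f x)) ≤ (1 - D.p a) * B (D.f x) :=
      mul_le_mul_of_nonneg_left h3 hp1
    have h5 : D.p a * (α * B (D.r a)) ≤ 1 * (1 * B (D.r a)) :=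
      mul_le_mul (D.p_le_one a) (mul_le_mul_of_nonneg_right hα.2.le hBr)
        (mul_nonneg hα.1.le hBr) zero_le_one
    unfold q
    nlinarith
  obtain ⟨V, hV⟩ := D.exists_isValue hα.1.le hW0 hWT
  refine ⟨V, hV, ?_⟩
  have h2 := hV.le_of_T_le _ hW0 hWT (D.r a)
  have h3 := mul_le_mul_of_nonneg_left h2 h1.le
  have h4 : (1 - α) * B (D.r a) ≤ 1 * B (D.r a) :=
    mul_le_mul_of_nonneg_right (by linarith [hα.1]) hBr
  linarith

/-- From `x`, repeating `a` reaches `r a` at the expected cost `B x`. In terms of value iteration,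
the minimum of `V` and `B + V (r a)` is a supersolution. -/
theorem IsResetBound.sub_le (hB : IsResetBound D a B) (hα : α ∈ Set.Ioo (0 : ℝ) 1)
    (hV : D.IsValue α V) (x : X) : V x - V (D.r a) ≤ B x := by
  have hp := D.p_nonneg a
  have hp1 : 0 ≤ 1 - D.p a := sub_nonneg.mpr (D.p_le_one a)
  have hv := hV.nonneg (D.r a)
  have key := hV.le_of_T_le (fun x => min (V x) (B x + V (D.r a)))
    (fun x => le_min (hV.nonneg x) (add_nonneg (hB.nonneg x) hv)) (fun x => le_min ?_ ?_) x
  · have := key.trans (min_le_right _ _)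
    linarith
  · exact (D.T_mono hα.1.le (fun y => min_le_left _ _) x).trans_eq (hV.fixed x)
  · refine (D.T_le_q _ _ x a).trans ?_
    have h1 : α * min (V (D.r a)) (B (D.r a) + V (D.r a)) ≤ V (D.r a) :=
      (mul_le_mul_of_nonneg_left (min_le_left _ _) hα.1.le).trans
        (mul_le_of_le_one_left hv hα.2.le)
    have h2 : α * min (V (D.f x)) (B (D.f x) + V (D.r a)) ≤ B (D.f x) + V (D.r a) :=
      (mul_le_mul_of_nonneg_left (min_le_right _ _) hα.1.le).trans
        (mul_le_of_le_one_left (add_nonneg (hB.nonneg _) hv) hα.2.le)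
    have h3 := mul_le_mul_of_nonneg_left h1 hp
    have h4 := mul_le_mul_of_nonneg_left h2 hp1
    have h5 := hB.step x
    unfold q
    nlinarith

/-- Every reset state that can be reached is, up to a constant, at least as expensive as `r a`:
from `r a`, it is reached by trying its action once after each reset to `r a`. -/
theorem IsResetBound.exists_reset_sub_le (hB : IsResetBound D a B) :
    ∃ N : ℝ, 0 ≤ N ∧ ∀ α ∈ Set.Ioo (0 : ℝ) 1, ∀ V, D.IsValue α V →
      ∀ b, 0 < D.p b → V (D.r a) - V (D.r b) ≤ N := by
  have hnum : ∀ b, 0 ≤ D.E b + D.c (D.r b) + D.c (D.f (D.r a)) + B (D.f (D.r a)) := fun b =>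
    add_nonneg (add_nonneg (add_nonneg (D.E_nonneg b) (D.c_nonneg _)) (D.c_nonneg _))
      (hB.nonneg _)
  refine ⟨∑ b, (D.E b + D.c (D.r b) + D.c (D.f (D.r a)) + B (D.f (D.r a))) / D.p b,
    Finset.sum_nonneg fun b _ => div_nonneg (hnum b) (D.p_nonneg b), fun α hα V hV b hb => ?_⟩
  refine le_trans ?_ (Finset.single_le_sum
    (f := fun b => (D.E b + D.c (D.r b) + D.c (D.f (D.r a)) + B (D.f (D.r a))) / D.p b)
    (fun b _ => div_nonneg (hnum b) (D.p_nonneg b)) (Finset.mem_univ b))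
  rw [le_div_iff₀ hb]
  have h1 := (hV.fixed (D.r a)).symm.trans_le (D.T_le_q α V (D.r a) b)
  have hp1 : 0 ≤ 1 - D.p b := sub_nonneg.mpr (D.p_le_one b)
  have h2 := hB.sub_le hα hV (D.f (D.r a))
  have h3 : α * V (D.r b) ≤ V (D.r b) := mul_le_of_le_one_left (hV.nonneg _) hα.2.le
  have h4 : α * V (D.f (D.r a)) ≤ V (D.f (D.r a)) :=
    mul_le_of_le_one_left (hV.nonneg _) hα.2.le
  have h5 : D.p b * (D.c (D.r b) + α * V (D.r b)) ≤ D.c (D.r b) + D.p b * V (D.r b) := by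
    have := mul_le_mul_of_nonneg_left h3 hb.le
    have := mul_le_of_le_one_left (D.c_nonneg (D.r b)) (D.p_le_one b)
    linarith
  have h6 : (1 - D.p b) * (D.c (D.f (D.r a)) + α * V (D.f (D.r a)))
      ≤ D.c (D.f (D.r a)) + B (D.f (D.r a)) + (1 - D.p b) * V (D.r a) := by
    have h7 : D.c (D.f (D.r a)) + α * V (D.f (D.r a))
        ≤ D.c (D.f (D.r a)) + B (D.f (D.r a)) + V (D.r a) := by linarith
    have h8 := mul_le_mul_of_nonneg_left h7 hp1
    have h9 : (1 - D.p b) * (D.c (D.f (D.r a)) + B (D.f (D.r a)))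
        ≤ D.c (D.f (D.r a)) + B (D.f (D.r a)) :=
      mul_le_of_le_one_left (add_nonneg (D.c_nonneg _) (hB.nonneg _)) (by linarith)
    linarith
  unfold q at h1
  linarith

/-- Far out on an orbit of `f` every stage costs more than the optimal average cost, so the value
there cannot fall far below that of `r a`; the remaining states of the orbit reach this region in
boundedly many steps, or are reset. -/
theorem IsResetBound.exists_le_sub (hB : IsResetBound D a B)
    {x : X} (hx : Tendsto (fun k => D.c (D.f^[k] x)) atTop atTop) :
    ∃ lo : ℝ, ∀ α ∈ Set.Ioo (0 : ℝ) 1, ∀ V, D.IsValue α V →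
      (1 - α) * V (D.r a) ≤ 2 * B (D.r a) → ∀ k, lo ≤ V (D.f^[k] x) - V (D.r a) := by
  obtain ⟨N, hN0, hN⟩ := hB.exists_reset_sub_le
  set J := 2 * B (D.r a) with hJ
  have hJ0 : 0 ≤ J := mul_nonneg two_pos.le (hB.nonneg _)
  obtain ⟨K, hK⟩ := eventually_atTop.mp (hx.eventually_ge_atTop (J + 1))
  refine ⟨-(J + N + 1) - K * J, fun α hα V hV hVJ => ?_⟩
  set v := V (D.r a) with hv
  -- one step from `y`, bounding the value after a reset
  have hstep : ∀ y, ∃ p : ℝ, 0 ≤ p ∧ p ≤ 1 ∧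
      p * (v - J - N) + (1 - p) * (D.c (D.f y) + α * V (D.f y)) ≤ V y := by
    intro y
    obtain ⟨b, hb⟩ := D.exists_T_eq_q α V y
    rw [hV.fixed] at hb
    refine ⟨D.p b, D.p_nonneg b, D.p_le_one b, ?_⟩
    have h1 : D.p b * (v - J - N) ≤ D.p b * (D.c (D.r b) + α * V (D.r b)) := by
      rcases (D.p_nonneg b).eq_or_lt with h0 | h0
      · rw [← h0, zero_mul, zero_mul]
      · have h2 := mul_le_mul_of_nonneg_left (hN α hα V hV b h0) hα.1.le
        have h3 : α * N ≤ N := mul_le_of_le_one_left hN0 hα.2.le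
        have h4 := D.c_nonneg (D.r b)
        refine mul_le_mul_of_nonneg_left ?_ h0.le
        rw [← hv] at h2
        linarith
    have h2 := D.E_nonneg b
    rw [hb, q]
    linarith
  -- if the infimum `I` over the far states were lower, then one step from a near-minimizer would
  -- cost at least `I + 1`, whether or not it ends in a reset
  have hfar : ∀ k, K ≤ k → v - (J + N + 1) ≤ V (D.f^[k] x) := by
    by_contra hcon
    push Not at hcon
    obtain ⟨k₀, hk₀, hlt⟩ := hcon
    have hbdd : BddBelow (Set.range fun k => V (D.f^[K + k] x)) :=
      ⟨0, by rintro _ ⟨k, rfl⟩; exact hV.nonneg _⟩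
    set I := ⨅ k, V (D.f^[K + k] x) with hI
    have hIlt : I < v - (J + N + 1) := by
      refine (ciInf_le hbdd (k₀ - K)).trans_lt ?_
      rwa [Nat.add_sub_cancel' hk₀]
    obtain ⟨k, hk⟩ := exists_lt_of_ciInf_lt (lt_add_one I)
    obtain ⟨p, hp0, hp1, hp⟩ := hstep (D.f^[K + k] x)
    have hcost : J + 1 ≤ D.c (D.f (D.f^[K + k] x)) := by
      rw [← Function.iterate_succ_apply' D.f]
      exact hK _ (by omega)
    have hnext : I ≤ V (D.f (D.f^[K + k] x)) := by
      rw [← Function.iterate_succ_apply' D.f]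
      exact ciInf_le hbdd (k + 1)
    have h1 : I + 1 ≤ D.c (D.f (D.f^[K + k] x)) + α * V (D.f (D.f^[K + k] x)) := by
      have h2 := mul_le_mul_of_nonneg_left hnext hα.1.le
      have h3 : (1 - α) * I ≤ (1 - α) * v :=
        mul_le_mul_of_nonneg_left (by linarith) (by linarith [hα.2])
      linarith
    have h2 := mul_le_mul_of_nonneg_left h1 (sub_nonneg.mpr hp1)
    have h3 : p * (I + 1) ≤ p * (v - J - N) := mul_le_mul_of_nonneg_left (by linarith) hp0
    linarith
  have hall : ∀ i k, K ≤ k + i → v - (J + N + 1) - i * J ≤ V (D.f^[k] x) := by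
    intro i
    induction i with
    | zero => intro k hk; simpa using hfar k hk
    | succ i ih =>
      intro k hk
      obtain ⟨p, hp0, hp1, hp⟩ := hstep (D.f^[k] x)
      rw [← Function.iterate_succ_apply' D.f] at hp
      have h1 := mul_le_mul_of_nonneg_left (ih (k + 1) (by omega)) hα.1.le
      have h0 : 0 ≤ J + N + 1 + i * J := by positivity
      have h2 : α * (J + N + 1 + i * J) ≤ J + N + 1 + i * J :=
        mul_le_of_le_one_left h0 hα.2.le
      have h3 : v - J - (J + N + 1 + i * J)
          ≤ D.c (D.f^[k + 1] x) + α * V (D.f^[k + 1] x) := by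
        have := D.c_nonneg (D.f^[k + 1] x)
        linarith
      have h4 := mul_le_mul_of_nonneg_left h3 (sub_nonneg.mpr hp1)
      have h5 : p * (v - J - (J + N + 1 + i * J)) ≤ p * (v - J - N) :=
        mul_le_mul_of_nonneg_left (by nlinarith) hp0
      push_cast
      linarith
  intro k
  have := hall K k (by omega)
  linarith

/-- The average cost Bellman equation has a solution when the cost of a cycle is finite and the
costs diverge on every orbit of `f`. -/
theorem IsResetBound.exists_bellman (hB : IsResetBound D a B)
    (hc : ∀ x, Tendsto (fun k => D.c (D.f^[k] x)) atTop atTop) :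
    ∃ (ρ : ℝ) (h : X → ℝ), (∀ x, ρ + h x = D.T 1 h x) ∧ (∀ x, h x ≤ B x) ∧
      ∀ x, ∃ lo, ∀ k, lo ≤ h (D.f^[k] x) := by
  classical
  choose! V hV hVJ using fun α (hα : α ∈ Set.Ioo (0 : ℝ) 1) => hB.exists_isValue hα
  choose lo hlo using fun x => hB.exists_le_sub (hc x)
  -- `lo x` bounds the relative values on the whole orbit of `x`, so the largest lower bound of the
  -- relative values at a state is at least `lo x` for each `x` whose orbit contains that state
  have hbdd : ∀ x, ∀ α ∈ Set.Ioo (0 : ℝ) 1, ∀ k, lo x ≤ V α (D.f^[k] x) - V α (D.r a) :=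
    fun x α hα => hlo x α hα (V α) (hV α hα) (hVJ α hα)
  set S : X → Set ℝ := fun x => {l | ∀ α ∈ Set.Ioo (0 : ℝ) 1, l ≤ V α x - V α (D.r a)} with hS
  have hSb : ∀ x, BddAbove (S x) := fun x =>
    ⟨V (1 / 2) x - V (1 / 2) (D.r a), fun l hl => hl (1 / 2) ⟨by norm_num, by norm_num⟩⟩
  have hSmem : ∀ x k, lo x ∈ S (D.f^[k] x) := fun x k α hα => hbdd x α hα k
  obtain ⟨ρ, h, hbell, hl, hu⟩ := D.exists_bellman_of_bounds (lo := fun x => sSup (S x)) hV hVJ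
    (fun α hα x => csSup_le ⟨lo x, hSmem x 0⟩ fun l hl => hl α hα)
    (fun α hα x => hB.sub_le hα (hV α hα) x)
  exact ⟨ρ, h, hbell, hu, fun x => ⟨lo x, fun k =>
    (le_csSup (hSb _) (hSmem x k)).trans (hl _)⟩⟩

end Reset

/-- If the costs along two orbits of `f` differ by a bounded total amount `G`, and waiting for
ever costs boundedly much per stage, then the average cost Bellman equation has a solution whose
variation is bounded by `G`. -/
theorem exists_bellman_of_contraction {a : A} (hp : D.p a = 0) (hE : D.E a = 0) {b : X → ℝ}
    (hb : ∀ x, D.c (D.f x) ≤ b x) (hbf : ∀ x, b (D.f x) ≤ b x) {G : X → X → ℝ}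
    (hG0 : ∀ x y, 0 ≤ G x y)
    (hG : ∀ x y, |D.c (D.f x) - D.c (D.f y)| + G (D.f x) (D.f y) ≤ G x y) (x₀ : X) :
    ∃ (ρ : ℝ) (h : X → ℝ), (∀ x, ρ + h x = D.T 1 h x) ∧ (∀ x, -G x₀ x ≤ h x) ∧
      ∀ x, h x ≤ G x x₀ := by
  have hb0 : ∀ x, 0 ≤ b x := fun x => (D.c_nonneg _).trans (hb x)
  have hval : ∀ α ∈ Set.Ioo (0 : ℝ) 1, ∃ V, D.IsValue α V ∧ (1 - α) * V x₀ ≤ b x₀ := by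
    intro α hα
    have h1 : 0 < 1 - α := by linarith [hα.2]
    have hW0 : ∀ x, 0 ≤ b x / (1 - α) := fun x => div_nonneg (hb0 x) h1.le
    have hWT : ∀ x, D.T α (fun x => b x / (1 - α)) x ≤ b x / (1 - α) := by
      intro x
      refine (D.T_le_q _ _ x a).trans ?_
      rw [q, hp, hE]
      have h2 : α * (b (D.f x) / (1 - α)) ≤ α * (b x / (1 - α)) :=
        mul_le_mul_of_nonneg_left ((div_le_div_iff_of_pos_right h1).mpr (hbf x)) hα.1.le
      have h3 : b x + α * (b x / (1 - α)) = b x / (1 - α) := by field_simp; ring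
      linarith [hb x]
    obtain ⟨V, hV⟩ := D.exists_isValue hα.1.le hW0 hWT
    refine ⟨V, hV, ?_⟩
    have h2 := mul_le_mul_of_nonneg_left (hV.le_of_T_le _ hW0 hWT x₀) h1.le
    rwa [mul_div_cancel₀ _ h1.ne'] at h2
  choose! V hV hVJ using hval
  have hlip : ∀ α ∈ Set.Ioo (0 : ℝ) 1, ∀ x y, V α x - V α y ≤ G x y := by
    intro α hα x y
    have hit : ∀ k x y, (D.T α)^[k] 0 x - (D.T α)^[k] 0 y ≤ G x y := by
      intro k
      induction k with
      | zero => intro x y; simpa using hG0 x y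
      | succ k ih =>
        intro x y
        rw [Function.iterate_succ_apply']
        set W := (D.T α)^[k] 0 with hW
        obtain ⟨d, hd⟩ := D.exists_T_eq_q α W y
        have h1 := D.T_le_q α W x d
        have hq : D.q α W x d - D.q α W y d = (1 - D.p d) *
            (D.c (D.f x) - D.c (D.f y) + α * (W (D.f x) - W (D.f y))) := by
          unfold q
          ring
        have h2 : α * (W (D.f x) - W (D.f y)) ≤ G (D.f x) (D.f y) :=
          (mul_le_mul_of_nonneg_left (ih _ _) hα.1.le).trans
            (mul_le_of_le_one_left (hG0 _ _) hα.2.le)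
        have h3 : D.c (D.f x) - D.c (D.f y) + α * (W (D.f x) - W (D.f y)) ≤ G x y := by
          linarith [hG x y, le_abs_self (D.c (D.f x) - D.c (D.f y))]
        have h4 : (1 - D.p d) *
            (D.c (D.f x) - D.c (D.f y) + α * (W (D.f x) - W (D.f y))) ≤ G x y :=
          (mul_le_mul_of_nonneg_left h3 (sub_nonneg.mpr (D.p_le_one d))).trans
            (mul_le_of_le_one_left (hG0 _ _) (by linarith [D.p_nonneg d]))
        linarith
    exact le_of_tendsto' (((hV α hα).tendsto x).sub ((hV α hα).tendsto y)) fun k => hit k x y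
  exact D.exists_bellman_of_bounds hV hVJ (fun α hα x => by linarith [hlip α hα x₀ x])
    fun α hα x => hlip α hα x x₀

end ResetProcess

/-! ### The Bellman equation of the scheduling problem -/

section Growth

variable {n M : ℕ} {s : System n M}

theorem posSemidef_f (hs : s.Admissible) {P : Matrix (Fin n) (Fin n) ℝ} (hP : P.PosSemidef) :
    (s.f P).PosSemidef :=
  (posSemidef_conj _ hP).add hs.posSemidef_Q

theorem posSemidef_iterate_f (hs : s.Admissible) {P : Matrix (Fin n) (Fin n) ℝ}
    (hP : P.PosSemidef) (k : ℕ) : (s.f^[k] P).PosSemidef := by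
  induction k with
  | zero => exact hP
  | succ k ih => rw [Function.iterate_succ_apply']; exact posSemidef_f hs ih

theorem iterate_f_eq (P : Matrix (Fin n) (Fin n) ℝ) (k : ℕ) :
    s.f^[k] P = s.A ^ k * P * (s.A ^ k)ᵀ
      + ∑ j ∈ Finset.range k, s.A ^ j * s.Q * (s.A ^ j)ᵀ := by
  induction k with
  | zero => simp
  | succ k ih =>
    rw [Function.iterate_succ_apply', ih, System.f, Finset.sum_range_succ', Matrix.mul_add,
      Matrix.add_mul, Matrix.mul_sum, Matrix.sum_mul, ← add_assoc]
    congr 1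
    · congr 1
      · rw [pow_succ', Matrix.transpose_mul]
        simp only [Matrix.mul_assoc]
      · refine Finset.sum_congr rfl fun j _ => ?_
        rw [pow_succ', Matrix.transpose_mul]
        simp only [Matrix.mul_assoc]
    · simp

theorem trace_iterate_f_sub (P P' : Matrix (Fin n) (Fin n) ℝ) (k : ℕ) :
    (s.f^[k] P).trace - (s.f^[k] P').trace = (s.A ^ k * (P - P') * (s.A ^ k)ᵀ).trace := by
  rw [iterate_f_eq, iterate_f_eq, ← Matrix.trace_sub, add_sub_add_right_eq_sub, ← Matrix.sub_mul,
    ← Matrix.mul_sub]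

theorem abs_trace_pow_conj_le {A : Matrix (Fin n) (Fin n) ℝ} {C t : ℝ} (hC : 0 ≤ C) (ht : 0 ≤ t)
    (hb : ∀ k i j, |(A ^ k) i j| ≤ C * t ^ k) (X : Matrix (Fin n) (Fin n) ℝ) (k : ℕ) :
    |(A ^ k * X * (A ^ k)ᵀ).trace| ≤ n * C ^ 2 * absSum X * (t ^ 2) ^ k :=
  (abs_trace_conj_le (by positivity) (hb k)).trans_eq (by ring)

theorem trace_iterate_f_le {C t : ℝ} (hC : 0 ≤ C) (ht : 0 ≤ t)
    (hb : ∀ k i j, |(s.A ^ k) i j| ≤ C * t ^ k) (P : Matrix (Fin n) (Fin n) ℝ) (k : ℕ) :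
    (s.f^[k] P).trace ≤ n * C ^ 2 * absSum P * (t ^ 2) ^ k
      + n * C ^ 2 * absSum s.Q * ∑ j ∈ Finset.range k, (t ^ 2) ^ j := by
  rw [iterate_f_eq, Matrix.trace_add, Matrix.trace_sum, Finset.mul_sum]
  exact add_le_add ((le_abs_self _).trans (abs_trace_pow_conj_le hC ht hb _ _))
    (Finset.sum_le_sum fun j _ => (le_abs_self _).trans (abs_trace_pow_conj_le hC ht hb _ _))

theorem bddAbove_trace_iterate_f (hA : IsStable s.A) (P : Matrix (Fin n) (Fin n) ℝ) :
    ∃ b, ∀ k, (s.f^[k] P).trace ≤ b := by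
  obtain ⟨C, r, hC, hr0, hr1, hb⟩ := hA.exists_abs_pow_apply_le
  have hr2 : r ^ 2 < 1 := pow_lt_one₀ hr0.le hr1 two_ne_zero
  have hP := absSum_nonneg P
  have hQ := absSum_nonneg s.Q
  refine ⟨n * C ^ 2 * absSum P * 1 + n * C ^ 2 * absSum s.Q * (1 - r ^ 2)⁻¹, fun k =>
    (trace_iterate_f_le hC hr0.le hb P k).trans ?_⟩
  gcongr
  · exact pow_le_one₀ (by positivity) hr2.le
  · rw [← tsum_geometric_of_lt_one (by positivity) hr2]
    exact (summable_geometric_of_lt_one (by positivity) hr2).sum_le_tsum _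
      fun j _ => by positivity

/-- Without measurements the error covariance of an unstable process diverges, because the noise
excites an unstable mode. -/
theorem tendsto_trace_iterate_f (hs : s.Admissible) (hA : ¬ IsStable s.A)
    {P : Matrix (Fin n) (Fin n) ℝ} (hP : P.PosSemidef) :
    Tendsto (fun k => (s.f^[k] P).trace) atTop atTop := by
  obtain ⟨a, b, u, v, h, hab⟩ := exists_isLeftEigenpair hA
  have hQ := noise_pos_of_isLeftEigenpair hs h hab
  obtain ⟨cu, hcu, hu⟩ := dotProduct_mulVec_le_trace u
  obtain ⟨cv, hcv, hv⟩ := dotProduct_mulVec_le_trace v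
  set w := u ⬝ᵥ s.Q *ᵥ u + v ⬝ᵥ s.Q *ᵥ v with hw
  have hgrow : ∀ k : ℕ, k * w ≤ u ⬝ᵥ (s.f^[k] P) *ᵥ u + v ⬝ᵥ (s.f^[k] P) *ᵥ v := by
    intro k
    have hk := posSemidef_iterate_f hs hP k
    have hku := dotProduct_mulVec_nonneg_of_posSemidef hk u
    have hkv := dotProduct_mulVec_nonneg_of_posSemidef hk v
    induction k with
    | zero => simpa using add_nonneg hku hkv
    | succ k ih =>
      have hk' := posSemidef_iterate_f hs hP k
      have hku' := dotProduct_mulVec_nonneg_of_posSemidef hk' u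
      have hkv' := dotProduct_mulVec_nonneg_of_posSemidef hk' v
      have h1 := ih hk' hku' hkv'
      have h2 := h.conj_add_conj (transpose_eq_of_posSemidef hk')
      have h3 := le_mul_of_one_le_left (add_nonneg hku' hkv') hab
      rw [Function.iterate_succ_apply', System.f]
      simp only [Matrix.add_mulVec, dotProduct_add]
      push_cast
      linarith
  have hpos : 0 < cu + cv + 1 := by positivity
  refine tendsto_atTop_mono (fun k => ?_)
    (tendsto_natCast_atTop_atTop.atTop_mul_const (div_pos hQ hpos))
  have hk := posSemidef_iterate_f hs hP k
  rw [← mul_div_assoc, div_le_iff₀ hpos]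
  have := hgrow k
  have := hu _ hk
  have := hv _ hk
  have := hk.trace_nonneg
  linarith

end Growth

/-- The scheduling problem as a controlled process with resets, on all positive semidefinite
matrices. The action `none` is to stay silent, and `some m` is to let sensor `m` alone transmit;
its reset state `P̄_m` is reached with probability `λ_m`. The reset state of `none` is never
reached. -/
noncomputable def System.process {n M : ℕ} (s : System n M) (hs : s.Admissible)
    (Pbar : Fin M → Matrix (Fin n) (Fin n) ℝ) (hPbar : ∀ m, (Pbar m).PosSemidef) :
    ResetProcess {P : Matrix (Fin n) (Fin n) ℝ // P.PosSemidef} (Option (Fin M)) where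
  f P := ⟨s.f P.1, posSemidef_f hs P.2⟩
  r a := a.elim ⟨0, Matrix.PosSemidef.zero⟩ fun m => ⟨Pbar m, hPbar m⟩
  c P := s.beta * P.1.trace
  p a := a.elim 0 s.lam
  E a := a.elim 0 fun m => (1 - s.beta) * s.E m
  c_nonneg P := mul_nonneg hs.beta_mem.1.le P.2.trace_nonneg
  p_nonneg a := by cases a with
    | none => exact le_rfl
    | some m => exact (hs.lam_mem m).1
  p_le_one a := by cases a with
    | none => exact zero_le_one
    | some m => exact (hs.lam_mem m).2
  E_nonneg a := by cases a with
    | none => exact le_rfl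
    | some m => exact mul_nonneg (by linarith [hs.beta_mem.2]) (hs.E_nonneg m)

section Bellman

variable {n M : ℕ} {s : System n M} (hs : s.Admissible)
  {Pbar : Fin M → Matrix (Fin n) (Fin n) ℝ} (hPbar : ∀ m, (Pbar m).PosSemidef)

theorem coe_iterate_process_f (P : {P : Matrix (Fin n) (Fin n) ℝ // P.PosSemidef}) (k : ℕ) :
    ((s.process hs Pbar hPbar).f^[k] P).1 = s.f^[k] P.1 := by
  induction k with
  | zero => rfl
  | succ k ih =>
    rw [Function.iterate_succ_apply', Function.iterate_succ_apply', ← ih]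
    rfl

theorem process_c_iterate (P : {P : Matrix (Fin n) (Fin n) ℝ // P.PosSemidef}) (k : ℕ) :
    (s.process hs Pbar hPbar).c ((s.process hs Pbar hPbar).f^[k] P)
      = s.beta * (s.f^[k] P.1).trace := by
  rw [← coe_iterate_process_f hs hPbar]
  rfl

theorem exists_bellman_of_isStable (hA : IsStable s.A) :
    ∃ (ρ : ℝ) (h : {P : Matrix (Fin n) (Fin n) ℝ // P.PosSemidef} → ℝ),
      (∀ x, ρ + h x = (s.process hs Pbar hPbar).T 1 h x) ∧
      (∃ a b, 0 ≤ b ∧ ∀ x, h x ≤ a + b * (s.process hs Pbar hPbar).c x) ∧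
      ∀ x, ∃ lo, ∀ k, lo ≤ h ((s.process hs Pbar hPbar).f^[k] x) := by
  set D := s.process hs Pbar hPbar with hD
  obtain ⟨C, r, hC, hr0, hr1, hb⟩ := hA.exists_abs_pow_apply_le
  have hr2 : r ^ 2 < 1 := pow_lt_one₀ hr0.le hr1 two_ne_zero
  have hβ := hs.beta_mem.1
  have hci : ∀ x k, D.c (D.f^[k] x) = s.beta * (s.f^[k] x.1).trace := process_c_iterate hs hPbar
  have hbd : ∀ x, BddAbove (Set.range fun k => D.c (D.f^[k + 1] x)) := by
    intro x
    obtain ⟨b, hb⟩ := bddAbove_trace_iterate_f (s := s) hA x.1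
    refine ⟨s.beta * b, ?_⟩
    rintro _ ⟨k, rfl⟩
    simp only [hci]
    exact mul_le_mul_of_nonneg_left (hb _) hβ.le
  -- the total difference of the costs along two silent orbits
  set g : {P : Matrix (Fin n) (Fin n) ℝ // P.PosSemidef} →
    {P : Matrix (Fin n) (Fin n) ℝ // P.PosSemidef} → ℕ → ℝ :=
    fun x y k => |D.c (D.f^[k + 1] x) - D.c (D.f^[k + 1] y)| with hg
  set K := s.beta * (n * C ^ 2) * (1 - r ^ 2)⁻¹ with hK
  have hK0 : 0 ≤ K := by
    have : 0 ≤ (1 - r ^ 2)⁻¹ := inv_nonneg.mpr (by linarith)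
    positivity
  have hgle : ∀ x y k, g x y k ≤ s.beta * (n * C ^ 2 * absSum (x.1 - y.1)) * (r ^ 2) ^ k := by
    intro x y k
    have h1 : g x y k = s.beta * |(s.A ^ (k + 1) * (x.1 - y.1) * (s.A ^ (k + 1))ᵀ).trace| := by
      simp only [hg, hci]
      rw [← mul_sub, abs_mul, abs_of_pos hβ, trace_iterate_f_sub]
    rw [h1, mul_assoc s.beta]
    refine mul_le_mul_of_nonneg_left ((abs_trace_pow_conj_le hC hr0.le hb _ _).trans ?_) hβ.le
    have := absSum_nonneg (x.1 - y.1)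
    exact mul_le_mul_of_nonneg_left
      (pow_le_pow_of_le_one (by positivity) hr2.le (Nat.le_succ k)) (by positivity)
  have hg0 : ∀ x y k, 0 ≤ g x y k := fun x y k => abs_nonneg _
  have hgs : ∀ x y, Summable (g x y) := fun x y =>
    Summable.of_nonneg_of_le (hg0 x y) (hgle x y)
      ((summable_geometric_of_lt_one (by positivity) hr2).mul_left _)
  have hGle : ∀ x y, ∑' k, g x y k ≤ K * absSum (x.1 - y.1) := by
    intro x y
    refine ((hgs x y).tsum_le_tsum (hgle x y)
      ((summable_geometric_of_lt_one (by positivity) hr2).mul_left _)).trans_eq ?_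
    rw [tsum_mul_left, tsum_geometric_of_lt_one (by positivity) hr2, hK]
    ring
  obtain ⟨ρ, h, hbell, hlo, hup⟩ := D.exists_bellman_of_contraction (a := none) rfl rfl
    (b := fun x => ⨆ k, D.c (D.f^[k + 1] x)) (fun x => le_ciSup (hbd x) 0)
    (fun x => ciSup_le fun k => le_ciSup (hbd x) (k + 1))
    (G := fun x y => ∑' k, g x y k) (fun x y => tsum_nonneg (hg0 x y))
    (fun x y => ((hgs x y).tsum_eq_zero_add).ge) ⟨0, Matrix.PosSemidef.zero⟩
  refine ⟨ρ, h, hbell, ⟨0, K * n ^ 2 / s.beta, by positivity, fun x => ?_⟩, fun x => ?_⟩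
  · refine (hup x).trans ((hGle x _).trans ?_)
    have h1 := mul_le_mul_of_nonneg_left (absSum_le_trace x.2) hK0
    have h2 : 0 + K * n ^ 2 / s.beta * D.c x = K * (n ^ 2 * x.1.trace) := by
      have : D.c x = s.beta * x.1.trace := rfl
      rw [this]
      field_simp
      ring
    rw [h2]
    simpa using h1
  · obtain ⟨b, hb⟩ := bddAbove_trace_iterate_f (s := s) hA x.1
    refine ⟨-(K * (n ^ 2 * b)), fun k => le_trans ?_ (hlo _)⟩
    refine neg_le_neg ((hGle _ _).trans (mul_le_mul_of_nonneg_left ?_ hK0))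
    have hk := coe_iterate_process_f hs hPbar x k
    have h1 : absSum ((0 : Matrix (Fin n) (Fin n) ℝ) - (D.f^[k] x).1) = absSum (D.f^[k] x).1 := by
      simp [absSum]
    change absSum ((0 : Matrix (Fin n) (Fin n) ℝ) - (D.f^[k] x).1) ≤ _
    rw [h1]
    refine (absSum_le_trace (D.f^[k] x).2).trans ?_
    rw [hD, hk]
    exact mul_le_mul_of_nonneg_left (hb k) (by positivity)

theorem exists_bellman_of_not_isStable (hA : ¬ IsStable s.A) {m : Fin M}
    (hm : s.lam m > 1 - 1 / maxAbsEigenvalue s.A ^ 2) :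
    ∃ (ρ : ℝ) (h : {P : Matrix (Fin n) (Fin n) ℝ // P.PosSemidef} → ℝ),
      (∀ x, ρ + h x = (s.process hs Pbar hPbar).T 1 h x) ∧
      (∃ a b, 0 ≤ b ∧ ∀ x, h x ≤ a + b * (s.process hs Pbar hPbar).c x) ∧
      ∀ x, ∃ lo, ∀ k, lo ≤ h ((s.process hs Pbar hPbar).f^[k] x) := by
  set D := s.process hs Pbar hPbar with hD
  have hβ := hs.beta_mem.1
  have hci : ∀ x k, D.c (D.f^[k] x) = s.beta * (s.f^[k] x.1).trace := process_c_iterate hs hPbar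
  have hσ := one_le_maxAbsEigenvalue hA
  set σ := maxAbsEigenvalue s.A with hσdef
  have hσ2 : 0 < σ ^ 2 := by positivity
  set l := 1 - s.lam m with hl
  have hl0 : 0 ≤ l := sub_nonneg.mpr (hs.lam_mem m).2
  have hlσ : l * σ ^ 2 < 1 := by
    have : l < 1 / σ ^ 2 := by linarith
    rwa [lt_div_iff₀ hσ2] at this
  have hl1 : l < 1 := lt_of_le_of_lt (le_mul_of_one_le_right hl0 (one_le_pow₀ hσ)) hlσ
  -- a growth rate `t` beyond the spectral radius that the loss probability still beats
  obtain ⟨t, hlt, hσt⟩ : ∃ t, l * t ^ 2 < 1 ∧ σ < t := by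
    have hcont : Continuous fun t : ℝ => l * t ^ 2 := by fun_prop
    have h1 : ∀ᶠ t in 𝓝[>] σ, l * t ^ 2 < 1 :=
      ((hcont.tendsto σ).eventually_lt_const hlσ).filter_mono nhdsWithin_le_nhds
    exact (h1.and self_mem_nhdsWithin).exists
  have ht1 : 1 < t := hσ.trans_lt hσt
  have ht2 : 1 < t ^ 2 := one_lt_pow₀ ht1 two_ne_zero
  obtain ⟨C, hC, hb⟩ := exists_abs_pow_apply_le_of_maxAbsEigenvalue_lt s.A hσt
  set w := absSum s.Q / (t ^ 2 - 1) with hw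
  have hw0 : 0 ≤ w := div_nonneg (absSum_nonneg _) (by linarith)
  have htr : ∀ (P : Matrix (Fin n) (Fin n) ℝ) k,
      (s.f^[k] P).trace ≤ n * C ^ 2 * (absSum P + w) * (t ^ 2) ^ k := by
    intro P k
    refine (trace_iterate_f_le hC (by linarith) hb P k).trans ?_
    have h1 : absSum s.Q * ∑ j ∈ Finset.range k, (t ^ 2) ^ j ≤ w * (t ^ 2) ^ k := by
      rw [geom_sum_eq ht2.ne', hw, div_mul_eq_mul_div, ← mul_div_assoc]
      have := absSum_nonneg s.Q
      have : 0 < t ^ 2 - 1 := by linarith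
      gcongr
      linarith
    have h2 := mul_le_mul_of_nonneg_left h1 (by positivity : (0 : ℝ) ≤ n * C ^ 2)
    linarith
  set e := D.E (some m) + D.p (some m) * D.c (D.r (some m)) with he
  have he0 : 0 ≤ e := add_nonneg (D.E_nonneg _) (mul_nonneg (D.p_nonneg _) (D.c_nonneg _))
  set g : {P : Matrix (Fin n) (Fin n) ℝ // P.PosSemidef} → ℕ → ℝ :=
    fun x k => l ^ k * (e + D.c (D.f^[k + 1] x)) with hg
  have hg0 : ∀ x k, 0 ≤ g x k := fun x k =>
    mul_nonneg (pow_nonneg hl0 k) (add_nonneg he0 (D.c_nonneg _))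
  have hgle : ∀ x k, g x k ≤ e * l ^ k
      + s.beta * (n * C ^ 2 * (absSum x.1 + w)) * t ^ 2 * (l * t ^ 2) ^ k := by
    intro x k
    have h1 := mul_le_mul_of_nonneg_left (htr x.1 (k + 1)) hβ.le
    have h2 := mul_le_mul_of_nonneg_left h1 (pow_nonneg hl0 k)
    simp only [hg, hci]
    calc _ = e * l ^ k + l ^ k * (s.beta * (s.f^[k + 1] x.1).trace) := by ring
      _ ≤ e * l ^ k
        + l ^ k * (s.beta * (n * C ^ 2 * (absSum x.1 + w) * (t ^ 2) ^ (k + 1))) := by gcongr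
      _ = _ := by rw [mul_pow l (t ^ 2) k, pow_succ (t ^ 2) k]; ring
  have hlt0 : 0 ≤ l * t ^ 2 := by positivity
  have hsum1 := (summable_geometric_of_lt_one hl0 hl1).mul_left e
  have hsum2 : ∀ x : {P : Matrix (Fin n) (Fin n) ℝ // P.PosSemidef}, Summable fun k =>
      s.beta * (n * C ^ 2 * (absSum x.1 + w)) * t ^ 2 * (l * t ^ 2) ^ k := fun x =>
    (summable_geometric_of_lt_one hlt0 hlt).mul_left _
  have hgs : ∀ x, Summable (g x) := fun x =>
    Summable.of_nonneg_of_le (hg0 x) (hgle x) (hsum1.add (hsum2 x))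
  have hB : ResetProcess.IsResetBound D (some m) fun x => ∑' k, g x k := by
    refine ⟨fun x => tsum_nonneg (hg0 x), fun x => ?_⟩
    have h1 : ∑' k, g x k = e + D.c (D.f x) + l * ∑' k, g (D.f x) k := by
      rw [(hgs x).tsum_eq_zero_add, ← tsum_mul_left]
      have h2 : g x 0 = e + D.c (D.f x) := by simp [hg]
      rw [h2]
      congr 1
      refine tsum_congr fun k => ?_
      simp only [hg, pow_succ, Function.iterate_succ_apply]
      ring
    have h2 : 1 - D.p (some m) = l := rfl
    have h3 := mul_le_mul_of_nonneg_right hl1.le (D.c_nonneg (D.f x))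
    change _ ≤ ∑' k, g x k
    rw [h1, h2, ← he]
    linarith
  have hc : ∀ x, Tendsto (fun k => D.c (D.f^[k] x)) atTop atTop := by
    intro x
    simp_rw [hci]
    exact (tendsto_trace_iterate_f hs hA x.2).const_mul_atTop hβ
  obtain ⟨ρ, h, hbell, hup, hlo⟩ := hB.exists_bellman hc
  set κ := s.beta * (n * C ^ 2) * t ^ 2 * (1 - l * t ^ 2)⁻¹ with hκ
  have hκ0 : 0 ≤ κ := by
    have : 0 ≤ (1 - l * t ^ 2)⁻¹ := inv_nonneg.mpr (by linarith)
    positivity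
  refine ⟨ρ, h, hbell, ⟨e * (1 - l)⁻¹ + κ * w, κ * n ^ 2 / s.beta, by positivity, fun x => ?_⟩, hlo⟩
  refine (hup x).trans
    (((hgs x).tsum_le_tsum (hgle x) (hsum1.add (hsum2 x))).trans ?_)
  rw [hsum1.tsum_add (hsum2 x), tsum_mul_left, tsum_mul_left,
    tsum_geometric_of_lt_one hl0 hl1, tsum_geometric_of_lt_one hlt0 hlt]
  have h1 := mul_le_mul_of_nonneg_left (absSum_le_trace x.2) hκ0
  have h2 : κ * n ^ 2 / s.beta * D.c x = κ * (n ^ 2 * x.1.trace) := by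
    have : D.c x = s.beta * x.1.trace := rfl
    rw [this]
    field_simp
  have h3 : s.beta * (n * C ^ 2 * (absSum x.1 + w)) * t ^ 2 * (1 - l * t ^ 2)⁻¹
      = κ * absSum x.1 + κ * w := by rw [hκ]; ring
  rw [h2, h3]
  linarith

end Bellman

/-! ### Decisions and transitions -/

section Actions

variable {n M : ℕ}

/-- The decision `e_0 = 0` or the unit vector `e_m`. -/
def toAction : Option (Fin M) → Action M
  | none => fun _ => false
  | some m => fun j => decide (j = m)

theorem actionsV_eq_range : actionsV M = Set.range (toAction : Option (Fin M) → Action M) := by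
  ext ν
  constructor
  · rintro (rfl | ⟨m, rfl⟩)
    · exact ⟨none, rfl⟩
    · exact ⟨some m, rfl⟩
  · rintro ⟨_ | m, rfl⟩
    · exact Or.inl rfl
    · exact Or.inr ⟨m, rfl⟩

theorem solo_toAction_none (m : Fin M) : solo (toAction none) m = 0 := by
  simp [solo, toAction, ind]

theorem solo_toAction_some (m j : Fin M) : solo (toAction (some m)) j = if j = m then 1 else 0 := by
  by_cases h : j = m
  · subst h
    rw [if_pos rfl, solo, Finset.prod_eq_one]
    · simp [toAction, ind]
    · intro i hi
      simp [toAction, ind, Finset.ne_of_mem_erase hi]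
  · simp [solo, toAction, ind, h]

/-- A decision either is a unit vector or has no sensor transmitting alone. -/
theorem eq_toAction_some_or_solo_eq_zero (ν : Action M) :
    (∃ m, ν = toAction (some m)) ∨ ∀ m, solo ν m = 0 := by
  by_cases h : ∀ m, solo ν m = 0
  · exact Or.inr h
  · push Not at h
    obtain ⟨m, hm⟩ := h
    left
    refine ⟨m, funext fun j => ?_⟩
    obtain ⟨h1, h2⟩ := mul_ne_zero_iff.mp hm
    by_cases hj : j = m
    · subst hj
      have : ν j = true := by
        by_contra hne
        exact h1 (by simp [ind, hne])
      simp [toAction, this]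
    · have h3 := Finset.prod_ne_zero_iff.mp h2 j (Finset.mem_erase.mpr ⟨hj, Finset.mem_univ j⟩)
      have : ν j = false := by
        by_contra hne
        exact h3 (by simp [ind, hne])
      simp [toAction, this, hj]

theorem next_of_solo_eq_zero (s : System n M) (Pbar : Fin M → Matrix (Fin n) (Fin n) ℝ)
    (P : Matrix (Fin n) (Fin n) ℝ) {ν : Action M} (hν : ∀ m, solo ν m = 0) (g : Fin M → Bool) :
    s.next Pbar P ν g = s.f P := by
  simp [System.next, hν]

theorem next_toAction_some (s : System n M) (Pbar : Fin M → Matrix (Fin n) (Fin n) ℝ)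
    (P : Matrix (Fin n) (Fin n) ℝ) (m : Fin M) (g : Fin M → Bool) :
    s.next Pbar P (toAction (some m)) g = if g m then Pbar m else s.f P := by
  have h : s.next Pbar P (toAction (some m)) g
      = ind (g m) • Pbar m + (1 - ind (g m)) • s.f P := by
    simp [System.next, solo_toAction_some]
  rw [h]
  cases g m <;> simp [ind]

/-- The successor is one of the states that `next` combines, so any function of it is the same
combination of the values. -/
theorem apply_next (s : System n M) (Pbar : Fin M → Matrix (Fin n) (Fin n) ℝ)
    (P : Matrix (Fin n) (Fin n) ℝ) (ν : Action M) (g : Fin M → Bool)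
    (u : Matrix (Fin n) (Fin n) ℝ → ℝ) :
    u (s.next Pbar P ν g) = (∑ m, solo ν m * ind (g m) * u (Pbar m))
      + (1 - ∑ m, solo ν m * ind (g m)) * u (s.f P) := by
  rcases eq_toAction_some_or_solo_eq_zero ν with ⟨m, rfl⟩ | h
  · have h1 : (∑ j, solo (toAction (some m)) j * ind (g j) * u (Pbar j))
        = ind (g m) * u (Pbar m) := by
      simp [solo_toAction_some]
    have h2 : ∑ j, solo (toAction (some m)) j * ind (g j) = ind (g m) := by
      simp [solo_toAction_some]
    rw [next_toAction_some, h1, h2]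
    cases g m <;> simp [ind]
  · rw [next_of_solo_eq_zero s Pbar P h]
    simp [h]

theorem mem_states_next (s : System n M) {Pbar : Fin M → Matrix (Fin n) (Fin n) ℝ}
    {P : Matrix (Fin n) (Fin n) ℝ} (hP : P ∈ s.states Pbar) (ν : Action M) (g : Fin M → Bool) :
    s.next Pbar P ν g ∈ s.states Pbar := by
  have hf : s.f P ∈ s.states Pbar := by
    obtain ⟨m, i, rfl⟩ := hP
    exact ⟨m, i + 1, (Function.iterate_succ_apply' _ _ _).symm⟩
  rcases eq_toAction_some_or_solo_eq_zero ν with ⟨m, rfl⟩ | h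
  · rw [next_toAction_some]
    split_ifs
    · exact ⟨m, 0, rfl⟩
    · exact hf
  · rwa [next_of_solo_eq_zero s Pbar P h]

theorem mem_states_remoteCov {Ω : Type*} (s : System n M)
    {Pbar : Fin M → Matrix (Fin n) (Fin n) ℝ} (γ : Fin M → ℕ → Ω → Bool) (π : Policy n M)
    {P₀ : Matrix (Fin n) (Fin n) ℝ} (hP₀ : P₀ ∈ s.states Pbar) (k : ℕ) (ω : Ω) :
    s.remoteCov Pbar γ π P₀ k ω ∈ s.states Pbar := by
  induction k with
  | zero => exact hP₀
  | succ k ih => exact mem_states_next s ih _ _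

end Actions

/-! ### Expectations along the controlled process -/

section Expectation

variable {n M : ℕ} (s : System n M) (Pbar : Fin M → Matrix (Fin n) (Fin n) ℝ)
  {Ω : Type*} (π : Policy n M) (P₀ : Matrix (Fin n) (Fin n) ℝ)

/-- The covariance at time `k` is a function of the channel up to time `k`. -/
theorem exists_remoteCov_eq (γ : Fin M → ℕ → Ω → Bool) (k : ℕ) :
    ∃ Φ : (((Finset.univ : Finset (Fin M)) ×ˢ Finset.range (k + 1) : Finset (Fin M × ℕ)) → Bool) →
      Matrix (Fin n) (Fin n) ℝ,
      ∀ ω, s.remoteCov Pbar γ π P₀ k ω = Φ fun i => γ i.1.1 i.1.2 ω := by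
  induction k with
  | zero => exact ⟨fun _ => P₀, fun _ => rfl⟩
  | succ k ih =>
    obtain ⟨Φ, hΦ⟩ := ih
    have hsub : ∀ i : Fin M × ℕ, i ∈ (Finset.univ : Finset (Fin M)) ×ˢ Finset.range (k + 1) →
        i ∈ (Finset.univ : Finset (Fin M)) ×ˢ Finset.range (k + 1 + 1) := by
      simp only [Finset.mem_product, Finset.mem_univ, true_and, Finset.mem_range]
      intro i hi
      omega
    have hmem : ∀ m : Fin M,
        (m, k + 1) ∈ (Finset.univ : Finset (Fin M)) ×ˢ Finset.range (k + 1 + 1) := by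
      simp
    refine ⟨fun g => s.next Pbar (Φ fun i => g ⟨i.1, hsub _ i.2⟩)
      (π (k + 1) (Φ fun i => g ⟨i.1, hsub _ i.2⟩)) fun m => g ⟨(m, k + 1), hmem m⟩, fun ω => ?_⟩
    rw [System.remoteCov, hΦ ω]

variable [MeasurableSpace Ω] {μ : Measure Ω} {γ : Fin M → ℕ → Ω → Bool}

theorem integrable_remoteCov [IsProbabilityMeasure μ] (hγ : IsBernoulliChannel μ s.lam γ) (k : ℕ)
    (u : Matrix (Fin n) (Fin n) ℝ → ℝ) :
    Integrable (fun ω => u (s.remoteCov Pbar γ π P₀ k ω)) μ := by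
  obtain ⟨Φ, hΦ⟩ := exists_remoteCov_eq s Pbar π P₀ γ k
  simp_rw [hΦ]
  have hmeas : Measurable fun ω => fun i : ((Finset.univ : Finset (Fin M)) ×ˢ
      Finset.range (k + 1) : Finset (Fin M × ℕ)) => γ i.1.1 i.1.2 ω :=
    measurable_pi_lambda _ fun i => hγ.measurable _ _
  exact (Integrable.of_finite (μ := μ.map _) (f := fun g => u (Φ g))).comp_measurable hmeas

theorem measurable_ind : Measurable ind := measurable_of_finite _

theorem integral_ind [IsProbabilityMeasure μ] (hs : s.Admissible)
    (hγ : IsBernoulliChannel μ s.lam γ) (m : Fin M) (k : ℕ) :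
    ∫ ω, ind (γ m k ω) ∂μ = s.lam m := by
  have h1 : (fun ω => ind (γ m k ω)) = Set.indicator {ω | γ m k ω = true} 1 := by
    ext ω
    by_cases h : γ m k ω = true <;> simp [ind, h]
  have h2 : MeasurableSet {ω | γ m k ω = true} := hγ.measurable m k (measurableSet_singleton true)
  rw [h1, integral_indicator_one h2, Measure.real, hγ.prob, ENNReal.toReal_ofReal (hs.lam_mem m).1]

/-- The channel at time `k + 1` is independent of the covariance at time `k`. -/
theorem integral_remoteCov_mul_ind [IsProbabilityMeasure μ] (hs : s.Admissible)
    (hγ : IsBernoulliChannel μ s.lam γ) (k : ℕ) (u : Matrix (Fin n) (Fin n) ℝ → ℝ) (m : Fin M) :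
    ∫ ω, u (s.remoteCov Pbar γ π P₀ k ω) * ind (γ m (k + 1) ω) ∂μ
      = (∫ ω, u (s.remoteCov Pbar γ π P₀ k ω) ∂μ) * s.lam m := by
  obtain ⟨Φ, hΦ⟩ := exists_remoteCov_eq s Pbar π P₀ γ k
  have hdisj : Disjoint ((Finset.univ : Finset (Fin M)) ×ˢ Finset.range (k + 1))
      ({(m, k + 1)} : Finset (Fin M × ℕ)) := by
    simp
  have hind := hγ.indep.indepFun_finset _ _ hdisj fun i => hγ.measurable _ _
  have hind2 := hind.comp (φ := fun g => u (Φ g))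
    (ψ := fun g => ind (g ⟨(m, k + 1), Finset.mem_singleton_self _⟩))
    (measurable_of_finite _) (measurable_of_finite _)
  rw [← integral_ind s hs hγ m (k + 1)]
  have h1 := integrable_remoteCov s Pbar π P₀ hγ k u
  have h2 : AEStronglyMeasurable (fun ω => ind (γ m (k + 1) ω)) μ :=
    (measurable_ind.comp (hγ.measurable m (k + 1))).aestronglyMeasurable
  simp_rw [hΦ] at h1 ⊢
  exact hind2.integral_fun_mul_eq_mul_integral h1.aestronglyMeasurable h2

theorem integrable_remoteCov_mul_ind [IsProbabilityMeasure μ]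
    (hγ : IsBernoulliChannel μ s.lam γ) (k : ℕ) (u : Matrix (Fin n) (Fin n) ℝ → ℝ) (m : Fin M) :
    Integrable (fun ω => u (s.remoteCov Pbar γ π P₀ k ω) * ind (γ m (k + 1) ω)) μ := by
  refine (integrable_remoteCov s Pbar π P₀ hγ k u).mul_bdd (c := 1)
    (measurable_ind.comp (hγ.measurable m (k + 1))).aestronglyMeasurable
    (Eventually.of_forall fun ω => ?_)
  cases γ m (k + 1) ω <;> simp [ind]

/-- One-step expectation: the Bernoulli variables are replaced by their means. -/
theorem integral_remoteCov_succ [IsProbabilityMeasure μ] (hs : s.Admissible)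
    (hγ : IsBernoulliChannel μ s.lam γ) (k : ℕ) (u : Matrix (Fin n) (Fin n) ℝ → ℝ) :
    ∫ ω, u (s.remoteCov Pbar γ π P₀ (k + 1) ω) ∂μ
      = ∫ ω, ((∑ m, solo (π (k + 1) (s.remoteCov Pbar γ π P₀ k ω)) m * s.lam m * u (Pbar m))
        + (1 - ∑ m, solo (π (k + 1) (s.remoteCov Pbar γ π P₀ k ω)) m * s.lam m)
          * u (s.f (s.remoteCov Pbar γ π P₀ k ω))) ∂μ := by
  set v : Fin M → Matrix (Fin n) (Fin n) ℝ → ℝ := fun m P =>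
    solo (π (k + 1) P) m * (u (Pbar m) - u (s.f P)) with hv
  have hL : ∀ ω, u (s.remoteCov Pbar γ π P₀ (k + 1) ω) = u (s.f (s.remoteCov Pbar γ π P₀ k ω))
      + ∑ m, v m (s.remoteCov Pbar γ π P₀ k ω) * ind (γ m (k + 1) ω) := by
    intro ω
    rw [System.remoteCov, apply_next s Pbar _ _ _ u, sub_mul, Finset.sum_mul, one_mul]
    simp only [hv]
    rw [add_sub_left_comm, ← Finset.sum_sub_distrib]
    congr 1
    exact Finset.sum_congr rfl fun m _ => by ring
  have hR : ∀ ω, (∑ m, solo (π (k + 1) (s.remoteCov Pbar γ π P₀ k ω)) m * s.lam m * u (Pbar m))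
        + (1 - ∑ m, solo (π (k + 1) (s.remoteCov Pbar γ π P₀ k ω)) m * s.lam m)
          * u (s.f (s.remoteCov Pbar γ π P₀ k ω))
      = u (s.f (s.remoteCov Pbar γ π P₀ k ω))
        + ∑ m, v m (s.remoteCov Pbar γ π P₀ k ω) * s.lam m := by
    intro ω
    rw [sub_mul, Finset.sum_mul, one_mul]
    simp only [hv]
    rw [add_sub_left_comm, ← Finset.sum_sub_distrib]
    congr 1
    exact Finset.sum_congr rfl fun m _ => by ring
  simp_rw [hL, hR]
  have h0 := integrable_remoteCov s Pbar π P₀ hγ k fun P => u (s.f P)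
  have h1 := fun m => integrable_remoteCov_mul_ind s Pbar π P₀ hγ k (v m) m
  have h2 := fun m => (integrable_remoteCov s Pbar π P₀ hγ k (v m)).mul_const (s.lam m)
  rw [integral_add h0 (integrable_finsetSum _ fun m _ => h1 m),
    integral_add h0 (integrable_finsetSum _ fun m _ => h2 m),
    integral_finsetSum _ fun m _ => h1 m, integral_finsetSum _ fun m _ => h2 m]
  congr 1
  refine Finset.sum_congr rfl fun m _ => ?_
  rw [integral_remoteCov_mul_ind s Pbar π P₀ hs hγ k (v m) m, integral_mul_const]

theorem integrable_stageCost [IsProbabilityMeasure μ] (hγ : IsBernoulliChannel μ s.lam γ) (k : ℕ) :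
    Integrable (s.stageCost Pbar γ π P₀ k) μ :=
  (integrable_remoteCov s Pbar π P₀ hγ (k + 1) fun P => s.beta * P.trace).add
    (integrable_remoteCov s Pbar π P₀ hγ k fun P =>
      (1 - s.beta) * ∑ m, ind (π (k + 1) P m) * s.E m)

/-- The expected stage cost plus the expected terminal value is the expected right-hand side of
the Bellman equation. -/
theorem integral_stageCost_add [IsProbabilityMeasure μ] (hs : s.Admissible)
    (hγ : IsBernoulliChannel μ s.lam γ) (k : ℕ) (h : Matrix (Fin n) (Fin n) ℝ → ℝ) :
    ∫ ω, s.stageCost Pbar γ π P₀ k ω ∂μ + ∫ ω, h (s.remoteCov Pbar γ π P₀ (k + 1) ω) ∂μ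
      = ∫ ω, s.bellmanRHS Pbar h (s.remoteCov Pbar γ π P₀ k ω)
          (π (k + 1) (s.remoteCov Pbar γ π P₀ k ω)) ∂μ := by
  have hT := integrable_remoteCov s Pbar π P₀ hγ (k + 1) fun P => s.beta * P.trace
  have hE := integrable_remoteCov s Pbar π P₀ hγ k fun P =>
    (1 - s.beta) * ∑ m, ind (π (k + 1) P m) * s.E m
  have hH := integrable_remoteCov s Pbar π P₀ hγ (k + 1) h
  have h1 : ∫ ω, s.stageCost Pbar γ π P₀ k ω ∂μ
      = ∫ ω, s.beta * (s.remoteCov Pbar γ π P₀ (k + 1) ω).trace ∂μ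
        + ∫ ω, (1 - s.beta) *
          ∑ m, ind (π (k + 1) (s.remoteCov Pbar γ π P₀ k ω) m) * s.E m ∂μ := integral_add hT hE
  have h2 := integral_add hT hH
  have h3 := integral_remoteCov_succ s Pbar π P₀ hs hγ k fun P => s.beta * P.trace + h P
  rw [h1, add_right_comm, ← h2, h3, ← integral_add _ hE]
  · refine integral_congr_ae (Eventually.of_forall fun ω => ?_)
    simp only [System.bellmanRHS, mul_add, Finset.sum_add_distrib, Finset.mul_sum]
    have : ∀ m, solo (π (k + 1) (s.remoteCov Pbar γ π P₀ k ω)) m * s.lam m *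
        (s.beta * (Pbar m).trace) = s.beta *
        (solo (π (k + 1) (s.remoteCov Pbar γ π P₀ k ω)) m * s.lam m * (Pbar m).trace) :=
      fun m => by ring
    simp only [this]
    ring
  · exact integrable_remoteCov s Pbar π P₀ hγ k fun P =>
      (∑ m, solo (π (k + 1) P) m * s.lam m * (s.beta * (Pbar m).trace + h (Pbar m)))
        + (1 - ∑ m, solo (π (k + 1) P) m * s.lam m) * (s.beta * (s.f P).trace + h (s.f P))

end Expectation

/-! ### Optimality from the Bellman equation -/

section Average

variable {g e : ℕ → ℝ} {ρ : ℝ}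

/-- If the terminal values `e k` are controlled by the stage costs `g k`, then the Bellman
inequality gives the lower bound `ρ` on the average cost. Were the average below `ρ`, the terminal
values would grow at least linearly, hence also the stage costs, and the average would diverge. -/
theorem le_limsup_average (hg : ∀ k, 0 ≤ g k) (h : ∀ k, ρ + e k ≤ g k + e (k + 1)) {a b : ℝ}
    (hb : 0 ≤ b) (he : ∀ k, e (k + 1) ≤ a + b * g k) :
    (ρ : EReal) ≤ limsup (fun K : ℕ =>
      (((1 / (K : ℝ)) * ∑ k ∈ Finset.range K, g k : ℝ) : EReal)) atTop := by
  by_contra hcon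
  rw [not_le] at hcon
  obtain ⟨r, hr1, hr2⟩ := EReal.lt_iff_exists_real_btwn.mp hcon
  have hrρ : r < ρ := by exact_mod_cast hr2
  have hev := eventually_lt_of_limsup_lt hr1
  have hsum : ∀ K : ℕ, K * ρ + e 0 ≤ ∑ k ∈ Finset.range K, g k + e K := by
    intro K
    induction K with
    | zero => simp
    | succ K ih =>
      rw [Finset.sum_range_succ]
      push_cast
      linarith [h K]
  have hev2 : ∀ᶠ K : ℕ in atTop, ∑ k ∈ Finset.range K, g k < r * K := by
    filter_upwards [hev, eventually_ge_atTop 1] with K hK hK1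
    have hK0 : (0 : ℝ) < K := by exact_mod_cast hK1
    have : (1 / (K : ℝ)) * ∑ k ∈ Finset.range K, g k < r := by exact_mod_cast hK
    rwa [one_div, inv_mul_lt_iff₀ hK0, mul_comm] at this
  -- the stage costs eventually exceed `|ρ| + 1`
  have hbig : ∀ᶠ K : ℕ in atTop, |ρ| + 1 ≤ g K := by
    have hlin : Tendsto (fun K : ℕ => ((K + 1 : ℕ) : ℝ) * (ρ - r)) atTop atTop :=
      (tendsto_natCast_atTop_atTop.comp (tendsto_add_atTop_nat 1)).atTop_mul_const
        (sub_pos.mpr hrρ)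
    filter_upwards [(tendsto_add_atTop_nat 1).eventually hev2,
      hlin.eventually_gt_atTop (a - e 0 + b * (|ρ| + 1))] with K hK hK2
    have h1 := hsum (K + 1)
    have h2 := he K
    by_contra hlt
    rw [not_le] at hlt
    have h3 := mul_le_mul_of_nonneg_left hlt.le hb
    linarith
  obtain ⟨K₀, hK₀⟩ := eventually_atTop.mp hbig
  have hgrow : ∀ j : ℕ, j * (|ρ| + 1) ≤ ∑ k ∈ Finset.range (K₀ + j), g k := by
    intro j
    induction j with
    | zero => simpa using Finset.sum_nonneg fun k _ => hg k
    | succ j ih =>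
      rw [← add_assoc, Finset.sum_range_succ]
      push_cast
      linarith [hK₀ (K₀ + j) (by omega)]
  obtain ⟨K₁, hK₁⟩ := eventually_atTop.mp hev2
  obtain ⟨j, hj⟩ := exists_nat_gt (|ρ| * K₀ + K₁)
  have hnn : 0 ≤ |ρ| * K₀ := by positivity
  have hjK : K₁ ≤ K₀ + j := by
    have : (K₁ : ℝ) ≤ j := by linarith
    have : K₁ ≤ j := by exact_mod_cast this
    omega
  have h1 := hK₁ (K₀ + j) hjK
  have h2 := hgrow j
  have h3 : r * ((K₀ + j : ℕ) : ℝ) ≤ |ρ| * ((K₀ + j : ℕ) : ℝ) :=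
    mul_le_mul_of_nonneg_right (hrρ.le.trans (le_abs_self ρ)) (by positivity)
  push_cast at h1 h3
  have h4 : (0 : ℝ) ≤ K₁ := by positivity
  linarith

/-- If the Bellman equation is attained at each stage and the terminal values are bounded below,
then the average cost is at most `ρ`. -/
theorem limsup_average_le (h : ∀ k, g k + e (k + 1) = ρ + e k) {lo : ℝ} (he : ∀ k, lo ≤ e k) :
    limsup (fun K : ℕ =>
      (((1 / (K : ℝ)) * ∑ k ∈ Finset.range K, g k : ℝ) : EReal)) atTop ≤ (ρ : EReal) := by
  have hsum : ∀ K : ℕ, ∑ k ∈ Finset.range K, g k = K * ρ + e 0 - e K := by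
    intro K
    induction K with
    | zero => simp
    | succ K ih =>
      rw [Finset.sum_range_succ, ih]
      push_cast
      linarith [h K]
  have hlim : Tendsto (fun K : ℕ => ((ρ + (e 0 - lo) / K : ℝ) : EReal)) atTop
      (𝓝 (ρ : EReal)) := by
    refine EReal.tendsto_coe.mpr ?_
    simpa using (tendsto_const_div_atTop_nhds_zero_nat (e 0 - lo)).const_add ρ
  rw [← hlim.limsup_eq]
  refine limsup_le_limsup ?_
  filter_upwards [eventually_ge_atTop 1] with K hK
  have hK0 : (0 : ℝ) < K := by exact_mod_cast hK
  refine EReal.coe_le_coe_iff.mpr ?_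
  rw [hsum, one_div, inv_mul_le_iff₀ hK0, mul_add, mul_div_cancel₀ _ hK0.ne']
  linarith [he K]

end Average

theorem bellmanRHS_toAction {n M : ℕ} {s : System n M} (hs : s.Admissible)
    {Pbar : Fin M → Matrix (Fin n) (Fin n) ℝ} (hPbar : ∀ m, (Pbar m).PosSemidef)
    {h : {P : Matrix (Fin n) (Fin n) ℝ // P.PosSemidef} → ℝ} {h' : Matrix (Fin n) (Fin n) ℝ → ℝ}
    (hh : ∀ x : {P : Matrix (Fin n) (Fin n) ℝ // P.PosSemidef}, h' x.1 = h x)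
    (x : {P : Matrix (Fin n) (Fin n) ℝ // P.PosSemidef}) (a : Option (Fin M)) :
    s.bellmanRHS Pbar h' x.1 (toAction a) = (s.process hs Pbar hPbar).q 1 h x a := by
  have hf : h' (s.f x.1) = h ⟨s.f x.1, posSemidef_f hs x.2⟩ := hh ⟨_, posSemidef_f hs x.2⟩
  cases a with
  | none =>
    simp only [System.bellmanRHS, solo_toAction_none, ResetProcess.q, System.process,
      Option.elim_none, hf]
    simp [toAction, ind]
  | some m =>
    have hm : h' (Pbar m) = h ⟨Pbar m, hPbar m⟩ := hh ⟨_, hPbar m⟩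
    have hE : ∑ j, ind (toAction (some m) j) * s.E j = s.E m := by
      simp [toAction, ind]
    simp only [System.bellmanRHS, solo_toAction_some, ResetProcess.q, System.process,
      Option.elim_some, hf, hE]
    simp [hm]
    ring

/-- Collisions are useless: staying silent is at most as expensive. -/
theorem exists_toAction_bellmanRHS_le {n M : ℕ} {s : System n M} (hs : s.Admissible)
    (Pbar : Fin M → Matrix (Fin n) (Fin n) ℝ) (h : Matrix (Fin n) (Fin n) ℝ → ℝ)
    (P : Matrix (Fin n) (Fin n) ℝ) (ν : Action M) :
    ∃ a, s.bellmanRHS Pbar h P (toAction a) ≤ s.bellmanRHS Pbar h P ν := by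
  rcases eq_toAction_some_or_solo_eq_zero ν with ⟨m, rfl⟩ | hν
  · exact ⟨some m, le_rfl⟩
  · refine ⟨none, ?_⟩
    have h1 : 0 ≤ (1 - s.beta) * ∑ m, ind (ν m) * s.E m :=
      mul_nonneg (by linarith [hs.beta_mem.2]) (Finset.sum_nonneg fun m _ =>
        mul_nonneg (by cases ν m <;> simp [ind]) (hs.E_nonneg m))
    simp only [System.bellmanRHS, hν, solo_toAction_none]
    simpa [toAction, ind] using h1

end SensorScheduling

open SensorScheduling in
theorem theorem2 {n M : ℕ} (s : SensorScheduling.System n M) (hs : s.Admissible)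
    (hA : SensorScheduling.IsStable s.A ∨
      ∃ m, s.lam m > 1 - 1 / SensorScheduling.maxAbsEigenvalue s.A ^ 2) :
    ∃ Pbar : Fin M → Matrix (Fin n) (Fin n) ℝ,
      -- the steady-state filtered covariances of the local Kalman filters
      (∀ m, Tendsto (s.localPost m) atTop (𝓝 (Pbar m))) ∧
      ∃ (ρ : ℝ) (h : Matrix (Fin n) (Fin n) ℝ → ℝ),
        -- the Bellman equation
        (∀ P ∈ s.states Pbar,
          IsLeast (s.bellmanRHS Pbar h P '' SensorScheduling.actionsV M) (ρ + h P)) ∧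
        -- a stationary policy `d` given by the minimum in the Bellman equation
        ∃ d : Matrix (Fin n) (Fin n) ℝ → SensorScheduling.Action M,
          (∀ P ∈ s.states Pbar,
            d P ∈ SensorScheduling.actionsV M ∧ s.bellmanRHS Pbar h P (d P) = ρ + h P) ∧
          -- for every realization of the channel, `ρ` is the optimal average cost from every
          -- initial state, and `d` attains it
          ∀ (Ω : Type*) [MeasurableSpace Ω] (μ : Measure Ω) [IsProbabilityMeasure μ]
            (γ : Fin M → ℕ → Ω → Bool), SensorScheduling.IsBernoulliChannel μ s.lam γ →
            ∀ P₀ ∈ s.states Pbar,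
              s.averageCost Pbar μ γ (fun _ => d) P₀ = ρ ∧
              ∀ π : SensorScheduling.Policy n M, (ρ : EReal) ≤ s.averageCost Pbar μ γ π P₀ := by
  choose Pbar hPbar hlim using fun m => exists_tendsto_localPost (s := s) m hs
  refine ⟨Pbar, hlim, ?_⟩
  obtain ⟨ρ, h, hbell, ⟨a, b, hb, hup⟩, hlo⟩ :
      ∃ (ρ : ℝ) (h : {P : Matrix (Fin n) (Fin n) ℝ // P.PosSemidef} → ℝ),
      (∀ x, ρ + h x = (s.process hs Pbar hPbar).T 1 h x) ∧
      (∃ a b, 0 ≤ b ∧ ∀ x, h x ≤ a + b * (s.process hs Pbar hPbar).c x) ∧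
      ∀ x, ∃ lo, ∀ k, lo ≤ h ((s.process hs Pbar hPbar).f^[k] x) := by
    by_cases hst : IsStable s.A
    · exact exists_bellman_of_isStable hs hPbar hst
    · obtain ⟨m, hm⟩ := hA.resolve_left hst
      exact exists_bellman_of_not_isStable hs hPbar hst hm
  classical
  set h' : Matrix (Fin n) (Fin n) ℝ → ℝ := fun P => if hP : P.PosSemidef then h ⟨P, hP⟩ else 0
    with hh'
  have hh : ∀ x : {P : Matrix (Fin n) (Fin n) ℝ // P.PosSemidef}, h' x.1 = h x := fun x => by
    simp [hh', x.2]
  have hpsd : ∀ P ∈ s.states Pbar, P.PosSemidef := by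
    rintro _ ⟨m, i, rfl⟩
    exact posSemidef_iterate_f hs (hPbar m) i
  have hle : ∀ P ∈ s.states Pbar, ∀ ν, ρ + h' P ≤ s.bellmanRHS Pbar h' P ν := by
    intro P hP ν
    obtain ⟨c, hc⟩ := exists_toAction_bellmanRHS_le hs Pbar h' P ν
    refine le_trans ?_ hc
    rw [bellmanRHS_toAction hs hPbar hh ⟨P, hpsd P hP⟩, hh ⟨P, hpsd P hP⟩, hbell]
    exact ResetProcess.T_le_q _ _ _ _ _
  have hatt : ∀ P, ∃ c, P ∈ s.states Pbar → s.bellmanRHS Pbar h' P (toAction c) = ρ + h' P := by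
    intro P
    by_cases hP : P ∈ s.states Pbar
    · obtain ⟨c, hc⟩ := (s.process hs Pbar hPbar).exists_T_eq_q 1 h ⟨P, hpsd P hP⟩
      refine ⟨c, fun _ => ?_⟩
      rw [bellmanRHS_toAction hs hPbar hh ⟨P, hpsd P hP⟩, hh ⟨P, hpsd P hP⟩, hbell, hc]
    · exact ⟨none, fun h => absurd h hP⟩
  choose d hd using hatt
  have hdV : ∀ P, toAction (d P) ∈ actionsV M := fun P => by
    rw [actionsV_eq_range]
    exact ⟨_, rfl⟩
  refine ⟨ρ, h', fun P hP => ⟨⟨_, hdV P, hd P hP⟩, ?_⟩, fun P => toAction (d P),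
    fun P hP => ⟨hdV P, hd P hP⟩, ?_⟩
  · rintro _ ⟨ν, -, rfl⟩
    exact hle P hP ν
  intro Ω _ μ _ γ hγ P₀ hP₀
  -- a common lower bound for `h` on the finitely many orbits that make up the state space
  obtain ⟨lo, hlo'⟩ : ∃ lo, ∀ P ∈ s.states Pbar, lo ≤ h' P := by
    choose l hl using hlo
    refine ⟨-∑ m, |l ⟨Pbar m, hPbar m⟩|, ?_⟩
    rintro _ ⟨m, i, rfl⟩
    have h1 := hl ⟨Pbar m, hPbar m⟩ i
    rw [← hh, coe_iterate_process_f hs hPbar] at h1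
    have h2 := Finset.single_le_sum (f := fun m => |l ⟨Pbar m, hPbar m⟩|)
      (fun m _ => abs_nonneg _) (Finset.mem_univ m)
    have h3 := neg_abs_le (l ⟨Pbar m, hPbar m⟩)
    simp only at h1 h2
    linarith
  have hstates := fun π => mem_states_remoteCov s γ π hP₀
  have hβ := hs.beta_mem
  have hcost : ∀ π k ω, s.beta * (s.remoteCov Pbar γ π P₀ (k + 1) ω).trace
      ≤ s.stageCost Pbar γ π P₀ k ω := by
    intro π k ω
    exact le_add_of_nonneg_right (mul_nonneg (by linarith [hβ.2]) (Finset.sum_nonneg fun m _ =>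
      mul_nonneg (by cases π (k + 1) (s.remoteCov Pbar γ π P₀ k ω) m <;> simp [ind])
        (hs.E_nonneg m)))
  have hRHS := fun π k => integrable_remoteCov s Pbar π P₀ hγ k fun P =>
    s.bellmanRHS Pbar h' P (π (k + 1) P)
  have hHint := fun π k => integrable_remoteCov s Pbar π P₀ hγ k h'
  have hlower : ∀ π : Policy n M, (ρ : EReal) ≤ s.averageCost Pbar μ γ π P₀ := by
    intro π
    refine le_limsup_average (e := fun k => ∫ ω, h' (s.remoteCov Pbar γ π P₀ k ω) ∂μ)
      (fun k => integral_nonneg fun ω => ?_) (fun k => ?_) (a := a) hb fun k => ?_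
    · exact (mul_nonneg hβ.1.le (hpsd _ (hstates π _ _)).trace_nonneg).trans (hcost π k ω)
    · rw [integral_stageCost_add s Pbar π P₀ hs hγ k h']
      have h1 : ρ + ∫ ω, h' (s.remoteCov Pbar γ π P₀ k ω) ∂μ
          = ∫ ω, (ρ + h' (s.remoteCov Pbar γ π P₀ k ω)) ∂μ := by
        rw [integral_add (integrable_const _) (hHint π k)]
        simp
      rw [h1]
      exact integral_mono ((integrable_const _).add (hHint π k)) (hRHS π k)
        fun ω => hle _ (hstates π k ω) _
    · have hS := integrable_stageCost s Pbar π P₀ hγ k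
      have h1 : a + b * ∫ ω, s.stageCost Pbar γ π P₀ k ω ∂μ
          = ∫ ω, (a + b * s.stageCost Pbar γ π P₀ k ω) ∂μ := by
        rw [integral_add (integrable_const _) (hS.const_mul b), integral_const_mul]
        simp
      rw [h1]
      refine integral_mono (hHint π (k + 1)) ((integrable_const _).add (hS.const_mul b))
        fun ω => ?_
      have h2 := hup ⟨_, hpsd _ (hstates π (k + 1) ω)⟩
      rw [← hh] at h2
      exact h2.trans (add_le_add_right (mul_le_mul_of_nonneg_left (hcost π k ω) hb) a)
  refine ⟨le_antisymm ?_ (hlower _), hlower⟩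
  refine limsup_average_le
    (e := fun k => ∫ ω, h' (s.remoteCov Pbar γ (fun _ P => toAction (d P)) P₀ k ω) ∂μ)
    (fun k => ?_) (lo := lo) fun k => ?_
  · rw [integral_stageCost_add s Pbar _ P₀ hs hγ k h']
    have h1 : ρ + ∫ ω, h' (s.remoteCov Pbar γ (fun _ P => toAction (d P)) P₀ k ω) ∂μ
        = ∫ ω, (ρ + h' (s.remoteCov Pbar γ (fun _ P => toAction (d P)) P₀ k ω)) ∂μ := by
      rw [integral_add (integrable_const _) (hHint _ k)]
      simp
    rw [h1]
    exact integral_congr_ae (Eventually.of_forall fun ω => hd _ (hstates _ k ω))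
  · have h1 : lo = ∫ _, lo ∂μ := by simp
    rw [h1]
    exact integral_mono (integrable_const _) (hHint _ k) fun ω => hlo' _ (hstates _ k ω)
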